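/- For each integer $n\ge 1$ let $X^{(n)}_1,X^{(n)}_2,X^{(n)}_3$ be independent random variables, each uniformly distributed on $\{1,2,\dots,n\}$. Let $$T_3=\prod_p\Big(1-\frac1p\Big)^2\Big(1+\frac2p\Big)$$ (product over all primes), let $\omega(m)$ be the number of distinct prime factors of $m$, let $$\Upsilon_3(m)=\prod_{p\mid m}\frac{1+1/p}{1+2/p}\qquad(\Upsilon_3(1)=1),$$ let $\Omega_3(s)$, for $s\ge 0$, be the volume of $\{(x_1,x_2,x_3)\in[0,1]^3:\ x_1x_2x_3\le s\}$, and let $$J(s)=\sum_{m=1}^\infty\frac{\Upsilon_3(m)\,3^{\omega(m)}}{m^s},\qquad \Re(s)>1.$$ Then the following hold; in particular, the product defining $T_3$ and the series below converge. a) For every real $t$ with $0\le t\le 1$, $$\lim_{n\to\infty}\mathbf P\big(\operatorname{lcm}(X^{(n)}_1,X^{(n)}_2,X^{(n)}_3)\le t\,n^3\big)=1-T_3\sum_{j=1}^\infty\frac1{j^3}\sum_{m=1}^\infty\frac{\Upsilon_3(m)\,3^{\omega(m)}}{m^2}\,\big(1-\Omega_3(t\,j^2m)\big).$$ b) For every integer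 $q\ge 1$, $$\lim_{n\to\infty}\frac{\mathbf E\big(\operatorname{lcm}(X^{(n)}_1,X^{(n)}_2,X^{(n)}_3)^q\big)}{n^{3q}}=T_3\,\frac{\zeta(2q+3)}{(q+1)^3}\,J(q+2),$$ where $\zeta$ is the Riemann zeta function. -/

import Mathlib

open MeasureTheory ProbabilityTheory Filter Topology

noncomputable section

namespace LcmTriples

/-- The factor at the prime `p` of the product defining `T_r`. -/
def factorT (r : ℕ) (p : ℕ) : ℝ :=
  (1 - 1 / (p : ℝ)) ^ (r - 1) * (1 + ((r : ℝ) - 1) / (p : ℝ))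

/-- `T_r = ∏_p (1 - 1/p)^(r-1) (1 + (r-1)/p)`, the product being over all primes (`r ≥ 2`). -/
def constT (r : ℕ) : ℝ :=
  ∏' p : Nat.Primes, factorT r p

/-- The part of the unit cube `[0,1]^r` where `x_1 ⋯ x_r ≤ s`. -/
def regionA (r : ℕ) (s : ℝ) : Set (Fin r → ℝ) :=
  {x | (∀ i, 0 ≤ x i ∧ x i ≤ 1) ∧ ∏ i, x i ≤ s}

/-- `Ω_r(s)`, the volume (Lebesgue measure) of `regionA r s`. -/
def volOmega (r : ℕ) (s : ℝ) : ℝ :=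
  volume.real (regionA r s)

/-- `Υ_r(m) = ∏_{p ∣ m} (1 + (r-2)/p) / (1 + (r-1)/p)`, so that `Υ_r(1) = 1`. -/
def upsilon (r m : ℕ) : ℝ :=
  ∏ p ∈ m.primeFactors,
    (1 + ((r : ℝ) - 2) / (p : ℝ)) / (1 + ((r : ℝ) - 1) / (p : ℝ))

/-- The arithmetic function `m ↦ Υ_3(m) 3^{ω(m)}`, where `ω(m)` is the number of distinct prime
factors of `m`. -/
def coeffJ (m : ℕ) : ℝ :=
  upsilon 3 m * 3 ^ ArithmeticFunction.cardDistinctFactors m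

/-- The Dirichlet series `J(s) = ∑_{m ≥ 1} Υ_3(m) 3^{ω(m)} m^{-s}`
(`LSeries` discards the term at `0`). -/
def seriesJ (s : ℂ) : ℂ :=
  LSeries (fun m : ℕ => (coeffJ m : ℂ)) s

/-- The least common multiple of a triple of natural numbers. -/
def lcmTriple (x : Fin 3 → ℕ) : ℕ :=
  Finset.univ.lcm x

end LcmTriples

end

namespace LcmTriples

/-! Write a triple as `x = j y` with `j` its greatest common divisor, and let `m` be the product of
the pairwise gcds of `y`. Since `y` has gcd 1, at every prime its sorted exponents are `0 ≤ b ≤ c`: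
the lcm carries `c` and `m` carries `b`, so `lcm(y) * m = ∏ y_i` and `lcm(x) * j² m = ∏ x_i`
(`lcmTriple_mul_gcdType`). Once the type `(j, m)` is fixed, both questions about the lcm become
questions about the product of the coordinates.

The product and the type are asymptotically independent (`MonoWeight.tendsto_gcdType`). A bounded
weight increasing in each coordinate has nearly equal sums over all residue classes, because a class
is carried to any other by a bounded translation. Having type `(j, m)` means divisibility by `j`
together with one condition at each prime `p`, depending only on residues modulo a power of `p`. For
finitely many primes the Chinese remainder theorem multiplies the local densities, and over all
primes this yields `T_3 Υ_3(m) 3^ω(m) / (m² j³)`.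

Two limits have to be exchanged: finitely many primes to all primes, and finitely many types to all
types. One bound serves both: at most a proportion `6 / R` of the triples have two coordinates with
a common divisor above `R`. It remains to sum over the types (`tendsto_sum_gcdType`), with weights
whose means are `1 - Ω_3` by lattice point counting and `(q + 1)⁻³`, up to a power of `j² m`, by
power sums. -/

/-- The triples of integers between `1` and `n`. -/
def box (n : ℕ) : Finset (Fin 3 → ℕ) :=
  Fintype.piFinset fun _ => Finset.Icc 1 n

lemma mem_box {n : ℕ} {x : Fin 3 → ℕ} : x ∈ box n ↔ ∀ i, 1 ≤ x i ∧ x i ≤ n := by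
  simp [box]

lemma card_box (n : ℕ) : (box n).card = n ^ 3 := by
  simp [box]

/-! ### Equidistribution of monotone weights in residue classes -/

/-- Weights with values in `[0, 1]` on the boxes that increase with each coordinate. -/
structure MonoWeight (w : ℕ → (Fin 3 → ℕ) → ℝ) : Prop where
  nonneg : ∀ n, ∀ x ∈ box n, 0 ≤ w n x
  le_one : ∀ n, ∀ x ∈ box n, w n x ≤ 1
  mono : ∀ n, Monotone (w n)

/-- Reduction of a triple modulo `Q`. -/
def residue (Q : ℕ) (x : Fin 3 → ℕ) : Fin 3 → ZMod Q := fun i => (x i : ZMod Q)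

/-- A point that leaves the box has some coordinate among the top `Q` values: three slabs of at most
`Q n²` points each. -/
lemma card_box_shift_notMem (n Q : ℕ) (s : Fin 3 → ℕ) (hs : ∀ i, s i ≤ Q) :
    ((box n).filter fun x => x + s ∉ box n).card ≤ 3 * (Q * n ^ 2) := by
  have hsub : ((box n).filter fun x => x + s ∉ box n) ⊆
      Finset.univ.biUnion fun i : Fin 3 => Fintype.piFinset fun k =>
        if k = i then Finset.Ioc (n - Q) n else Finset.Icc 1 n := by
    intro x hx
    simp only [Finset.mem_filter, mem_box, Pi.add_apply, not_forall] at hx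
    obtain ⟨hx, i, hi⟩ := hx
    simp only [Finset.mem_biUnion, Finset.mem_univ, true_and, Fintype.mem_piFinset]
    refine ⟨i, fun k => ?_⟩
    have h1 := hx k
    by_cases hk : k = i
    · subst hk
      have h2 := hs k
      simp only [if_true, Finset.mem_Ioc]
      omega
    · simpa [hk] using h1
  refine (Finset.card_le_card hsub).trans (Finset.card_biUnion_le.trans ?_)
  have : ∀ i ∈ (Finset.univ : Finset (Fin 3)), (Fintype.piFinset fun k =>
        if k = i then Finset.Ioc (n - Q) n else Finset.Icc 1 n).card ≤ Q * n ^ 2 := by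
    intro i _
    rw [Fintype.card_piFinset, Fin.prod_univ_three]
    have h : n - (n - Q) ≤ Q := by omega
    fin_cases i <;> simp <;> nlinarith [Nat.mul_le_mul_right (n * n) h]
  refine (Finset.sum_le_sum this).trans ?_
  simp

/-- A translation with entries in `[0, Q)` carries the class `a` into the class `b`. It does not
decrease the weight, and each point pushed out of the box costs at most 1. -/
lemma MonoWeight.sum_residue_le {w : ℕ → (Fin 3 → ℕ) → ℝ} (hw : MonoWeight w) (n Q : ℕ) [NeZero Q]
    (a b : Fin 3 → ZMod Q) :
    ∑ x ∈ (box n).filter (fun x => residue Q x = a), w n x ≤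
      ∑ x ∈ (box n).filter (fun x => residue Q x = b), w n x + 3 * (Q * (n : ℝ) ^ 2) := by
  classical
  set s : Fin 3 → ℕ := fun i => (b i - a i).val with hs
  have hsQ : ∀ i, s i ≤ Q := fun i => (ZMod.val_lt _).le
  rw [← Finset.sum_filter_add_sum_filter_not _ (fun x => x + s ∈ box n)]
  refine add_le_add ?_ ?_
  · calc _ ≤ ∑ x ∈ ((box n).filter (fun x => residue Q x = a)).filter (fun x => x + s ∈ box n),
          w n (x + s) := Finset.sum_le_sum fun x _ => hw.mono n (le_add_of_nonneg_right zero_le)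
      _ = ∑ x ∈ (((box n).filter (fun x => residue Q x = a)).filter
          (fun x => x + s ∈ box n)).map (addRightEmbedding s), w n x := by
        rw [Finset.sum_map]; rfl
      _ ≤ _ := by
        refine Finset.sum_le_sum_of_subset_of_nonneg ?_ ?_
        · intro y hy
          simp only [Finset.mem_map, Finset.mem_filter, addRightEmbedding_apply] at hy ⊢
          obtain ⟨x, ⟨⟨-, hx⟩, hx'⟩, rfl⟩ := hy
          refine ⟨hx', ?_⟩
          funext i
          have := congrFun hx i
          simp only [residue] at this
          simp [residue, this, hs]
        · intro y hy _
          exact hw.nonneg n y (Finset.mem_filter.1 hy).1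
  · calc _ ≤ ∑ x ∈ ((box n).filter (fun x => residue Q x = a)).filter (fun x => x + s ∉ box n),
          (1 : ℝ) := Finset.sum_le_sum fun x hx =>
            hw.le_one n x (Finset.mem_filter.1 (Finset.mem_filter.1 hx).1).1
      _ ≤ (((box n).filter fun x => x + s ∉ box n).card : ℝ) := by
        rw [Finset.sum_const, nsmul_one, Nat.cast_le]
        refine Finset.card_le_card fun x hx => ?_
        simp only [Finset.mem_filter] at hx ⊢
        exact ⟨hx.1.1, hx.2⟩
      _ ≤ _ := by exact_mod_cast card_box_shift_notMem n Q s hsQ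

/-- Summing the comparison of two classes over all `Q ^ 3` classes, in both directions, compares one
class with the mean. -/
lemma MonoWeight.abs_sum_residue_sub_le {w : ℕ → (Fin 3 → ℕ) → ℝ} (hw : MonoWeight w) (n Q : ℕ)
    [NeZero Q] (a : Fin 3 → ZMod Q) :
    |∑ x ∈ (box n).filter (fun x => residue Q x = a), w n x - (∑ x ∈ box n, w n x) / Q ^ 3| ≤
      3 * (Q * (n : ℝ) ^ 2) := by
  classical
  have hQ : (0 : ℝ) < (Q : ℝ) ^ 3 := by
    have := Nat.pos_of_ne_zero (NeZero.ne Q)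
    positivity
  have htot : ∑ x ∈ box n, w n x =
      ∑ b : Fin 3 → ZMod Q, ∑ x ∈ (box n).filter (fun x => residue Q x = b), w n x :=
    (Finset.sum_fiberwise _ _ _).symm
  have hcard : (Fintype.card (Fin 3 → ZMod Q) : ℝ) = (Q : ℝ) ^ 3 := by
    simp [ZMod.card]
  have h1 : (∑ x ∈ box n, w n x) ≤
      Q ^ 3 * (∑ x ∈ (box n).filter (fun x => residue Q x = a), w n x + 3 * (Q * (n : ℝ) ^ 2)) := by
    rw [htot]
    refine (Finset.sum_le_sum fun b _ => hw.sum_residue_le n Q b a).trans (le_of_eq ?_)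
    rw [Finset.sum_const, nsmul_eq_mul, Finset.card_univ, hcard]
  have h2 : Q ^ 3 * (∑ x ∈ (box n).filter (fun x => residue Q x = a), w n x) ≤
      (∑ x ∈ box n, w n x) + Q ^ 3 * (3 * (Q * (n : ℝ) ^ 2)) := by
    have := Finset.sum_le_sum fun b (_ : b ∈ (Finset.univ : Finset (Fin 3 → ZMod Q))) =>
      hw.sum_residue_le n Q a b
    rwa [Finset.sum_add_distrib, ← htot, Finset.sum_const, Finset.sum_const, nsmul_eq_mul,
      nsmul_eq_mul, Finset.card_univ, hcard] at this
  rw [abs_le]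
  constructor
  · have : (∑ x ∈ box n, w n x) / Q ^ 3 ≤ _ := (div_le_iff₀' hQ).2 h1
    linarith
  · rw [sub_le_iff_le_add, ← sub_le_iff_le_add', le_div_iff₀' hQ]
    linarith

lemma MonoWeight.tendsto_residue {w : ℕ → (Fin 3 → ℕ) → ℝ} (hw : MonoWeight w) {I : ℝ}
    (hI : Tendsto (fun n : ℕ => (∑ x ∈ box n, w n x) / (n : ℝ) ^ 3) atTop (𝓝 I))
    (Q : ℕ) [NeZero Q] (a : Fin 3 → ZMod Q) :
    Tendsto (fun n : ℕ => (∑ x ∈ (box n).filter (fun x => residue Q x = a), w n x) / (n : ℝ) ^ 3)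
      atTop (𝓝 (I / Q ^ 3)) := by
  have h0 : Tendsto (fun n : ℕ => (3 * Q : ℝ) / n) atTop (𝓝 0) :=
    tendsto_const_div_atTop_nhds_zero_nat _
  have h1 := hI.div_const ((Q : ℝ) ^ 3)
  refine h1.congr_dist (squeeze_zero' (Eventually.of_forall fun _ => dist_nonneg) ?_ h0)
  filter_upwards [eventually_gt_atTop 0] with n hn
  have hn' : (0 : ℝ) < n := by exact_mod_cast hn
  rw [dist_comm, Real.dist_eq, div_right_comm, ← sub_div, abs_div, abs_of_pos (pow_pos hn' 3),
    div_le_div_iff₀ (pow_pos hn' 3) hn']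
  have := mul_le_mul_of_nonneg_right (hw.abs_sum_residue_sub_le n Q a) hn'.le
  linarith

/-- Divisibility by `j` with prescribed quotient modulo `Q` is a single class modulo `j * Q`, so no
equidistribution beyond that of classes is needed. -/
lemma dvd_and_residue_div_eq_iff (j Q : ℕ) [NeZero j] [NeZero Q] (x : Fin 3 → ℕ)
    (b : Fin 3 → ZMod Q) :
    ((∀ i, j ∣ x i) ∧ residue Q (fun i => x i / j) = b) ↔
      residue (j * Q) x = fun i => ((j * (b i).val : ℕ) : ZMod (j * Q)) := by
  simp only [residue, funext_iff, ZMod.natCast_eq_natCast_iff, ← forall_and]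
  refine forall_congr' fun i => ?_
  have hj : 0 < j := Nat.pos_of_ne_zero (NeZero.ne j)
  have hb : ∀ y : ℕ, (y : ZMod Q) = b i ↔ y ≡ (b i).val [MOD Q] := by
    intro y
    rw [← ZMod.natCast_eq_natCast_iff, ZMod.natCast_zmod_val]
  constructor
  · rintro ⟨⟨y, hy⟩, h⟩
    rw [hy, Nat.mul_div_cancel_left _ hj, hb] at h
    rw [hy]
    exact h.mul_left' j
  · intro h
    have hd : j ∣ x i := by
      have h' : x i ≡ j * (b i).val [MOD j] := h.of_mul_right Q
      exact (h'.dvd_iff dvd_rfl).2 (dvd_mul_right _ _)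
    refine ⟨hd, ?_⟩
    obtain ⟨y, hy⟩ := hd
    rw [hy] at h ⊢
    rw [Nat.mul_div_cancel_left _ hj, hb]
    exact Nat.ModEq.mul_left_cancel' hj.ne' h

/-- Equidistribution of a monotone weight over the triples divisible by `j` whose quotient by `j`
has its residue modulo `Q` in a given set. -/
lemma MonoWeight.tendsto_periodic {w : ℕ → (Fin 3 → ℕ) → ℝ} (hw : MonoWeight w) {I : ℝ}
    (hI : Tendsto (fun n : ℕ => (∑ x ∈ box n, w n x) / (n : ℝ) ^ 3) atTop (𝓝 I))
    (j Q : ℕ) [NeZero j] [NeZero Q] (B : Finset (Fin 3 → ZMod Q)) :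
    Tendsto (fun n : ℕ => (∑ x ∈ (box n).filter
        (fun x => (∀ i, j ∣ x i) ∧ residue Q (fun i => x i / j) ∈ B), w n x) / (n : ℝ) ^ 3)
      atTop (𝓝 (B.card / (Q : ℝ) ^ 3 / j ^ 3 * I)) := by
  classical
  have hsum : ∀ n, ∑ x ∈ (box n).filter
        (fun x => (∀ i, j ∣ x i) ∧ residue Q (fun i => x i / j) ∈ B), w n x =
      ∑ b ∈ B, ∑ x ∈ (box n).filter (fun x => residue (j * Q) x =
        fun i => ((j * (b i).val : ℕ) : ZMod (j * Q))), w n x := by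
    intro n
    rw [← Finset.sum_fiberwise_of_maps_to (s := (box n).filter _) (t := B)
      (g := fun x => residue Q (fun i => x i / j)) (fun x hx => (Finset.mem_filter.1 hx).2.2)]
    refine Finset.sum_congr rfl fun b hb => Finset.sum_congr ?_ fun _ _ => rfl
    ext x
    simp only [Finset.mem_filter, ← dvd_and_residue_div_eq_iff]
    constructor
    · rintro ⟨⟨h1, h2, h3⟩, h4⟩
      exact ⟨h1, h2, h4⟩
    · rintro ⟨h1, h2, h4⟩
      exact ⟨⟨h1, h2, h4 ▸ hb⟩, h4⟩
  have hB : (B.card / (Q : ℝ) ^ 3 / j ^ 3 * I) = ∑ _b ∈ B, I / ((j * Q : ℕ) : ℝ) ^ 3 := by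
    rw [Finset.sum_const, nsmul_eq_mul]
    push_cast
    rw [mul_pow]
    ring
  rw [hB]
  have h := tendsto_finsetSum B fun b (_ : b ∈ B) =>
    hw.tendsto_residue hI (j * Q) fun i => ((j * (b i).val : ℕ) : ZMod (j * Q))
  refine h.congr fun n => ?_
  rw [hsum, Finset.sum_div]

/-! ### Triples with two coordinates sharing a large divisor -/

lemma card_box_common_dvd_le (n d : ℕ) (i j : Fin 3) (hij : i ≠ j) :
    ((box n).filter fun x => d ∣ x i ∧ d ∣ x j).card ≤ (n / d) ^ 2 * n := by
  have hsub : ((box n).filter fun x => d ∣ x i ∧ d ∣ x j) ⊆ Fintype.piFinset fun k =>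
      if k = i ∨ k = j then (Finset.Ioc 0 n).filter (d ∣ ·) else Finset.Icc 1 n := by
    intro x hx
    simp only [Finset.mem_filter, mem_box] at hx
    simp only [Fintype.mem_piFinset]
    intro k
    have h := hx.1 k
    split_ifs with hk
    · rw [Finset.mem_filter, Finset.mem_Ioc]
      rcases hk with rfl | rfl
      exacts [⟨by omega, hx.2.1⟩, ⟨by omega, hx.2.2⟩]
    · simpa using h
  refine (Finset.card_le_card hsub).trans (le_of_eq ?_)
  rw [Fintype.card_piFinset, Fin.prod_univ_three]
  fin_cases i <;> fin_cases j <;> simp [Nat.Ioc_filter_dvd_card_eq_div] at hij ⊢ <;>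
    (try left) <;> ring

/-- Two coordinates have a common divisor exceeding `R`. -/
def HasLargeCommonDvd (R : ℕ) (x : Fin 3 → ℕ) : Prop :=
  ∃ d, R < d ∧ ∃ i j, i ≠ j ∧ d ∣ x i ∧ d ∣ x j

open Classical in
/-- Few triples in a box have two coordinates with a large common divisor. -/
lemma card_box_large_common_dvd_le (n R : ℕ) (hR : 0 < R) :
    (((box n).filter (HasLargeCommonDvd R)).card : ℝ) ≤
      6 / R * (n : ℝ) ^ 3 := by
  rcases le_or_gt n R with hn | hn
  · rw [Finset.filter_false_of_mem, Finset.card_empty, Nat.cast_zero]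
    · positivity
    · rintro x hx ⟨d, hd, i, j, -, hi, -⟩
      have h1 := mem_box.1 hx i
      have := Nat.le_of_dvd (by omega) hi
      omega
  have hsub : (box n).filter (HasLargeCommonDvd R) ⊆
      (Finset.Ioc R n).biUnion fun d => (Finset.univ : Finset (Fin 3)).offDiag.biUnion fun ij =>
        (box n).filter fun x => d ∣ x ij.1 ∧ d ∣ x ij.2 := by
    intro x hx
    simp only [Finset.mem_filter] at hx
    obtain ⟨hx, d, hd, i, j, hij, hi, hj⟩ := hx
    simp only [Finset.mem_biUnion, Finset.mem_Ioc, Finset.mem_filter, Finset.mem_offDiag,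
      Finset.mem_univ, true_and, Prod.exists]
    have h1 := mem_box.1 hx i
    have := Nat.le_of_dvd (by omega) hi
    exact ⟨d, ⟨hd, by omega⟩, i, j, hij, hx, hi, hj⟩
  -- The 6 counts ordered pairs of distinct indices.
  have hcard : ((box n).filter (HasLargeCommonDvd R)).card ≤
      ∑ d ∈ Finset.Ioc R n, 6 * ((n / d) ^ 2 * n) := by
    refine (Finset.card_le_card hsub).trans (Finset.card_biUnion_le.trans ?_)
    refine Finset.sum_le_sum fun d _ => Finset.card_biUnion_le.trans ?_
    refine (Finset.sum_le_card_nsmul _ _ ((n / d) ^ 2 * n) fun ij hij => ?_).trans (le_of_eq ?_)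
    · exact card_box_common_dvd_le n d _ _ (Finset.mem_offDiag.1 hij).2.2
    · simp [Finset.offDiag_card]
  calc _ ≤ ((∑ d ∈ Finset.Ioc R n, 6 * ((n / d) ^ 2 * n) : ℕ) : ℝ) := by exact_mod_cast hcard
    _ ≤ ∑ d ∈ Finset.Ioc R n, 6 * (n : ℝ) ^ 3 * ((d : ℝ) ^ 2)⁻¹ := by
      rw [Nat.cast_sum]
      refine Finset.sum_le_sum fun d _ => ?_
      push_cast
      have h : ((n / d : ℕ) : ℝ) ^ 2 ≤ ((n : ℝ) / d) ^ 2 :=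
        pow_le_pow_left₀ (Nat.cast_nonneg _) Nat.cast_div_le 2
      calc _ ≤ 6 * (((n : ℝ) / d) ^ 2 * n) := by gcongr
        _ = _ := by rw [div_pow, div_eq_mul_inv]; ring
    -- The sum of `1 / d²` over `R < d ≤ n` telescopes to at most `1 / R - 1 / n`.
    _ ≤ 6 * (n : ℝ) ^ 3 * (R : ℝ)⁻¹ := by
      rw [← Finset.mul_sum]
      have h1 := sum_Ioc_inv_sq_le_sub (α := ℝ) hR.ne' hn.le
      have h2 : (0 : ℝ) ≤ (n : ℝ)⁻¹ := by positivity
      gcongr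
      linarith
    _ = _ := by ring

/-! ### Types described by conditions at each prime -/

/-- One coordinate is prime to `p`, the other two have greatest common divisor of exact
`p`-order `e`. -/
def LocalCond (p e : ℕ) (y : Fin 3 → ℕ) : Prop :=
  ∃ i, ¬ p ∣ y i ∧ (∀ k, k ≠ i → p ^ e ∣ y k) ∧ ∃ k, k ≠ i ∧ ¬ p ^ (e + 1) ∣ y k

/-- The greatest common divisor of a triple. -/
def tripleGcd (y : Fin 3 → ℕ) : ℕ := Nat.gcd (y 0) (Nat.gcd (y 1) (y 2))

/-- The product of the greatest common divisors of the pairs in a triple. -/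
def pairGcd (y : Fin 3 → ℕ) : ℕ :=
  Nat.gcd (y 0) (y 1) * Nat.gcd (y 0) (y 2) * Nat.gcd (y 1) (y 2)

lemma tripleGcd_ne_zero {y : Fin 3 → ℕ} (hy : ∀ i, y i ≠ 0) : tripleGcd y ≠ 0 :=
  Nat.gcd_ne_zero_left (hy 0)

lemma pairGcd_ne_zero {y : Fin 3 → ℕ} (hy : ∀ i, y i ≠ 0) : pairGcd y ≠ 0 :=
  mul_ne_zero (mul_ne_zero (Nat.gcd_ne_zero_left (hy 0)) (Nat.gcd_ne_zero_left (hy 0)))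
    (Nat.gcd_ne_zero_left (hy 1))

lemma tripleGcd_dvd (y : Fin 3 → ℕ) (i : Fin 3) : tripleGcd y ∣ y i := by
  have h := Nat.gcd_dvd_right (y 0) (Nat.gcd (y 1) (y 2))
  fin_cases i
  exacts [Nat.gcd_dvd_left _ _, h.trans (Nat.gcd_dvd_left _ _), h.trans (Nat.gcd_dvd_right _ _)]

/-- If the sorted exponents of `p` are `a ≤ b ≤ c`, the triple gcd has exponent `a` and the product
of pair gcds has `2a + b`. With `a = 0` the latter is the minimum over the two remaining
coordinates. After passing to exponents this is linear arithmetic with minima. -/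
lemma localCond_iff {p : ℕ} (hp : p.Prime) (e : ℕ) {y : Fin 3 → ℕ} (hy : ∀ i, y i ≠ 0) :
    LocalCond p e y ↔
      (tripleGcd y).factorization p = 0 ∧ (pairGcd y).factorization p = e := by
  have h0 := hy 0
  have h1 := hy 1
  have h2 := hy 2
  have hpow : ∀ (i : Fin 3) (k : ℕ), p ^ k ∣ y i ↔ k ≤ (y i).factorization p := fun i k =>
    hp.pow_dvd_iff_le_factorization (hy i)
  have hone : ∀ i : Fin 3, p ∣ y i ↔ 1 ≤ (y i).factorization p := fun i => by
    rw [← hpow, pow_one]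
  unfold LocalCond tripleGcd pairGcd
  rw [Nat.factorization_mul (mul_ne_zero (Nat.gcd_ne_zero_left h0) (Nat.gcd_ne_zero_left h0))
    (Nat.gcd_ne_zero_left h1), Nat.factorization_mul (Nat.gcd_ne_zero_left h0)
    (Nat.gcd_ne_zero_left h0), Nat.factorization_gcd h0 (Nat.gcd_ne_zero_left h1),
    Nat.factorization_gcd h1 h2, Nat.factorization_gcd h0 h1, Nat.factorization_gcd h0 h2]
  simp only [hpow, hone, Finsupp.coe_add, Pi.add_apply, Finsupp.inf_apply]
  simp only [Fin.exists_fin_succ, Fin.forall_fin_succ, Fin.isValue]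
  simp
  omega

lemma tripleGcd_pairGcd_iff {y : Fin 3 → ℕ} (hy : ∀ i, y i ≠ 0) {m : ℕ} (hm : m ≠ 0) :
    (tripleGcd y = 1 ∧ pairGcd y = m) ↔
      ∀ p : Nat.Primes, LocalCond p (m.factorization p) y := by
  constructor
  · rintro ⟨h1, h2⟩ p
    rw [localCond_iff p.2 _ hy, h1, h2]
    simp
  · intro h
    have h' := fun p : Nat.Primes => (localCond_iff p.2 _ hy).1 (h p)
    constructor
    · refine Nat.eq_of_factorization_eq (tripleGcd_ne_zero hy) one_ne_zero fun p => ?_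
      by_cases hp : p.Prime
      · simpa using (h' ⟨p, hp⟩).1
      · simp [Nat.factorization_eq_zero_of_not_prime _ hp]
    · refine Nat.eq_of_factorization_eq (pairGcd_ne_zero hy) hm fun p => ?_
      by_cases hp : p.Prime
      · exact (h' ⟨p, hp⟩).2
      · simp [Nat.factorization_eq_zero_of_not_prime _ hp]

lemma localCond_mod_iff {p : ℕ} (e : ℕ) (y : Fin 3 → ℕ) :
    LocalCond p e (fun i => y i % p ^ (e + 1)) ↔ LocalCond p e y := by
  unfold LocalCond
  have h1 : ∀ a, p ∣ a % p ^ (e + 1) ↔ p ∣ a := fun a =>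
    Nat.dvd_mod_iff (dvd_pow_self p e.succ_ne_zero)
  have h2 : ∀ a, p ^ e ∣ a % p ^ (e + 1) ↔ p ^ e ∣ a := fun a =>
    Nat.dvd_mod_iff (pow_dvd_pow p e.le_succ)
  have h3 : ∀ a, p ^ (e + 1) ∣ a % p ^ (e + 1) ↔ p ^ (e + 1) ∣ a := fun a =>
    Nat.dvd_mod_iff dvd_rfl
  simp only [h1, h2, h3]

open Classical in
/-- The residues modulo `p ^ (e + 1)` satisfying the local condition. -/
noncomputable def localSet (p e : ℕ) [NeZero p] : Finset (Fin 3 → ZMod (p ^ (e + 1))) :=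
  Finset.univ.filter fun a => LocalCond p e fun i => (a i).val

lemma residue_mem_localSet (p e : ℕ) [NeZero p] (y : Fin 3 → ℕ) :
    residue (p ^ (e + 1)) y ∈ localSet p e ↔ LocalCond p e y := by
  simp only [localSet, Finset.mem_filter, Finset.mem_univ, true_and, residue, ZMod.val_natCast]
  exact localCond_mod_iff e y

/-! ### Counting residues that satisfy a local condition -/

/-- The reflection `a ↦ N - a` moves the representatives `0, …, N - 1` to `1, …, N`, where multiples
of `d` are counted by `N / d`. -/
lemma card_dvd_val (N d : ℕ) [NeZero N] (hd : d ∣ N) :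
    (Finset.univ.filter fun a : ZMod N => d ∣ a.val).card = N / d := by
  rw [← Nat.Ioc_filter_dvd_card_eq_div]
  refine Finset.card_nbij' (fun a => N - a.val) (fun m => ((N - m : ℕ) : ZMod N)) ?_ ?_ ?_ ?_
  · intro a ha
    have h := ZMod.val_lt a
    simp only [Finset.coe_filter, Finset.mem_univ, true_and, Set.mem_ofPred_eq,
      Finset.mem_Ioc] at ha ⊢
    exact ⟨by omega, Nat.dvd_sub hd ha⟩
  · intro m hm
    simp only [Finset.coe_filter, Finset.mem_univ, true_and, Set.mem_ofPred_eq,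
      Finset.mem_Ioc] at hm ⊢
    rw [ZMod.val_natCast, Nat.dvd_mod_iff hd]
    exact Nat.dvd_sub hd hm.2
  · intro a _
    have h := ZMod.val_lt a
    simp [Nat.sub_sub_self h.le]
  · intro m hm
    simp only [Finset.coe_filter, Set.mem_ofPred_eq, Finset.mem_Ioc] at hm
    simp only [ZMod.val_natCast]
    rw [Nat.mod_eq_of_lt (by omega)]
    omega

/-- The density of the local condition. -/
noncomputable def localDensity (p e : ℕ) : ℝ :=
  if e = 0 then factorT 3 p else 3 * (1 - 1 / (p : ℝ)) ^ 2 * (1 + 1 / (p : ℝ)) / (p : ℝ) ^ (2 * e)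

lemma card_unit_val {p : ℕ} (e : ℕ) [NeZero p] :
    ((Finset.univ.filter fun a : ZMod (p ^ (e + 1)) => ¬ p ∣ a.val).card : ℝ) =
      (p : ℝ) ^ (e + 1) - (p : ℝ) ^ e := by
  have hp := Nat.pos_of_ne_zero (NeZero.ne p)
  have h := Finset.card_filter_add_card_filter_not (s := Finset.univ)
    (fun a : ZMod (p ^ (e + 1)) => p ∣ a.val)
  rw [card_dvd_val _ _ (dvd_pow_self p e.succ_ne_zero), Finset.card_univ, ZMod.card,
    Nat.div_eq_of_eq_mul_left hp (pow_succ p e)] at h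
  have h' := congrArg (fun k : ℕ => (k : ℝ)) h
  push_cast at h'
  linarith

/-- For `e = 0` the condition says that at least two coordinates are units: either all three, or
exactly two with the third equal to 0 modulo `p`. -/
lemma card_localSet_zero {p : ℕ} (hp : p.Prime) [NeZero p] :
    ((localSet p 0).card : ℝ) = ((p : ℝ) - 1) ^ 3 + 3 * ((p : ℝ) - 1) ^ 2 := by
  classical
  set U := Finset.univ.filter fun a : ZMod (p ^ (0 + 1)) => ¬ p ∣ a.val with hU
  set E := Finset.univ.filter fun a : ZMod (p ^ (0 + 1)) => p ∣ a.val with hE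
  have hUc : (U.card : ℝ) = p - 1 := by rw [hU, card_unit_val]; simp
  have hEc : E.card = 1 := by
    rw [hE, card_dvd_val _ _ (by simp), zero_add, pow_one, Nat.div_self hp.pos]
  have hset : localSet p 0 = (Fintype.piFinset fun _ => U) ∪
      Finset.univ.biUnion fun i : Fin 3 => Fintype.piFinset fun k => if k = i then E else U := by
    ext a
    simp only [localSet, LocalCond, Finset.mem_filter, Finset.mem_univ, true_and,
      Finset.mem_union, Fintype.mem_piFinset, Finset.mem_biUnion, Fin.exists_fin_succ,
      Fin.forall_fin_succ, hU, hE]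
    simp
    tauto
  have hd1 : Disjoint (Fintype.piFinset fun _ : Fin 3 => U)
      (Finset.univ.biUnion fun i : Fin 3 => Fintype.piFinset fun k => if k = i then E else U) := by
    rw [Finset.disjoint_left]
    intro a ha hb
    simp only [Fintype.mem_piFinset, Finset.mem_biUnion, Finset.mem_univ, true_and] at ha hb
    obtain ⟨i, hi⟩ := hb
    have h1 := ha i
    have h2 := hi i
    simp [hU, hE] at h1 h2
    exact h1 h2
  rw [hset, Finset.card_union_of_disjoint hd1, Finset.card_biUnion]
  · simp only [Fintype.card_piFinset, Fin.prod_univ_three, Fin.sum_univ_three]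
    simp
    rw [hUc, hEc]
    push_cast
    ring
  · intro i _ j _ hij
    rw [Function.onFun, Finset.disjoint_left]
    intro a ha hb
    rw [Fintype.mem_piFinset] at ha hb
    have h1 := ha i
    have h2 := hb i
    simp [hij, hU, hE] at h1 h2
    exact h2 h1

/-- For `e > 0` the unit coordinate is unique, hence the factor 3. The other two are among the `p`
multiples of `p ^ e` and not both 0, which leaves `p² - 1` choices. -/
lemma card_localSet_pos {p e : ℕ} (hp : p.Prime) (he : e ≠ 0) [NeZero p] :
    ((localSet p e).card : ℝ) =
      3 * (((p : ℝ) ^ (e + 1) - (p : ℝ) ^ e) * ((p : ℝ) ^ 2 - 1)) := by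
  classical
  set U := Finset.univ.filter fun a : ZMod (p ^ (e + 1)) => ¬ p ∣ a.val with hU
  set E := Finset.univ.filter fun a : ZMod (p ^ (e + 1)) => p ^ e ∣ a.val with hE
  set Z := Finset.univ.filter fun a : ZMod (p ^ (e + 1)) => p ^ (e + 1) ∣ a.val with hZ
  have hEU : ∀ a ∈ E, a ∉ U := by
    intro a ha hb
    simp only [hE, hU, Finset.mem_filter, Finset.mem_univ, true_and] at ha hb
    exact hb ((dvd_pow_self p he).trans ha)
  have hZE : Z ⊆ E := by
    intro a ha
    simp only [hE, hZ, Finset.mem_filter, Finset.mem_univ, true_and] at ha ⊢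
    exact (pow_dvd_pow p e.le_succ).trans ha
  have hUc : (U.card : ℝ) = (p : ℝ) ^ (e + 1) - (p : ℝ) ^ e := card_unit_val e
  have hEc : E.card = p := by
    rw [hE, card_dvd_val _ _ (pow_dvd_pow p e.le_succ), pow_succ,
      Nat.mul_div_cancel_left _ (pow_pos hp.pos e)]
  have hZc : Z.card = 1 := by
    rw [hZ, card_dvd_val _ _ dvd_rfl, Nat.div_self (pow_pos hp.pos _)]
  have hset : localSet p e = Finset.univ.biUnion fun i : Fin 3 =>
      (Fintype.piFinset fun k => if k = i then U else E) \
        (Fintype.piFinset fun k => if k = i then U else Z) := by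
    ext a
    simp only [localSet, LocalCond, Finset.mem_filter, Finset.mem_univ, true_and,
      Finset.mem_sdiff, Fintype.mem_piFinset, Finset.mem_biUnion, Fin.exists_fin_succ,
      Fin.forall_fin_succ, hU, hE, hZ]
    simp
    tauto
  rw [hset, Finset.card_biUnion]
  · have : ∀ i ∈ (Finset.univ : Finset (Fin 3)),
        (((Fintype.piFinset fun k => if k = i then U else E) \
        (Fintype.piFinset fun k => if k = i then U else Z)).card : ℝ) =
        ((p : ℝ) ^ (e + 1) - (p : ℝ) ^ e) * ((p : ℝ) ^ 2 - 1) := by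
      intro i _
      rw [Finset.cast_card_sdiff]
      · simp only [Fintype.card_piFinset, Fin.prod_univ_three]
        fin_cases i <;> simp [hUc, hEc, hZc] <;> ring
      · refine Fintype.piFinset_subset _ _ fun k => ?_
        split_ifs
        exacts [subset_rfl, hZE]
    rw [Nat.cast_sum, Finset.sum_congr rfl this]
    simp
  · intro i _ j _ hij
    rw [Function.onFun, Finset.disjoint_left]
    intro a ha hb
    rw [Finset.mem_sdiff, Fintype.mem_piFinset] at ha hb
    have h1 := ha.1 i
    have h2 := hb.1 i
    simp [hij] at h1 h2
    exact hEU _ h2 h1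

lemma card_localSet_div {p : ℕ} (hp : p.Prime) (e : ℕ) [NeZero p] :
    ((localSet p e).card : ℝ) / ((p : ℝ) ^ (e + 1)) ^ 3 = localDensity p e := by
  have hp0 : (p : ℝ) ≠ 0 := by exact_mod_cast hp.ne_zero
  unfold localDensity
  split_ifs with he
  · subst he
    rw [card_localSet_zero hp, factorT, show 3 - 1 = 2 from rfl]
    push_cast
    field_simp
    ring
  · rw [card_localSet_pos hp he]
    field_simp
    ring

/-! ### Finitely many primes: the Chinese remainder theorem -/

instance (p : Nat.Primes) : NeZero (p : ℕ) := ⟨p.2.ne_zero⟩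

/-- The modulus to which the local conditions at the primes of `S` refer. -/
def modulus (S : Finset Nat.Primes) (e : Nat.Primes → ℕ) : ℕ :=
  ∏ p : S, (p.1 : ℕ) ^ (e p.1 + 1)

instance (S : Finset Nat.Primes) (e : Nat.Primes → ℕ) : NeZero (modulus S e) :=
  ⟨Finset.prod_ne_zero_iff.2 fun p _ => pow_ne_zero _ p.1.2.ne_zero⟩

/-- The local conditions at the primes of a finite set define a set of residues of the expected
density. -/
lemma exists_residues (S : Finset Nat.Primes) (e : Nat.Primes → ℕ) :
    ∃ B : Finset (Fin 3 → ZMod (modulus S e)),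
      (∀ y : Fin 3 → ℕ, residue (modulus S e) y ∈ B ↔ ∀ p ∈ S, LocalCond p (e p) y) ∧
      (B.card : ℝ) / (modulus S e : ℝ) ^ 3 = ∏ p ∈ S, localDensity p (e p) := by
  classical
  have hcop : Pairwise (Function.onFun Nat.Coprime fun p : S => (p.1 : ℕ) ^ (e p.1 + 1)) := by
    intro p q hpq
    refine Nat.Coprime.pow _ _ ((Nat.coprime_primes p.1.2 q.1.2).2 fun h => hpq ?_)
    exact Subtype.ext (Subtype.ext h)
  let c : ZMod (modulus S e) ≃+* Π p : S, ZMod ((p.1 : ℕ) ^ (e p.1 + 1)) :=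
    ZMod.prodEquivPi _ hcop
  -- The Chinese remainder isomorphism in each coordinate, followed by exchanging coordinates and
  -- primes, turns the conditions into a product set.
  let E : (Fin 3 → ZMod (modulus S e)) ≃ Π p : S, Fin 3 → ZMod ((p.1 : ℕ) ^ (e p.1 + 1)) :=
    (Equiv.piCongrRight fun _ => c.toEquiv).trans (Equiv.piComm _)
  refine ⟨Finset.univ.filter fun a => E a ∈ Fintype.piFinset fun p : S => localSet p.1 (e p.1),
    fun y => ?_, ?_⟩
  · have hE : ∀ p : S, E (residue (modulus S e) y) p = residue ((p.1 : ℕ) ^ (e p.1 + 1)) y := by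
      intro p
      funext i
      change c ((y i : ℕ) : ZMod (modulus S e)) p = _
      rw [map_natCast]
      rfl
    simp only [Finset.mem_filter, Finset.mem_univ, true_and, Fintype.mem_piFinset, hE,
      residue_mem_localSet]
    exact Subtype.forall
  · rw [Finset.card_equiv E (t := Fintype.piFinset fun p : S => localSet p.1 (e p.1))
      (by simp), Fintype.card_piFinset, modulus]
    push_cast
    rw [← Finset.prod_pow, ← Finset.prod_div_distrib,
      ← Finset.prod_coe_sort S fun p => localDensity p (e p)]
    exact Finset.prod_congr rfl fun p _ => card_localSet_div p.1.2 _

/-! ### The type of a triple -/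

lemma tripleGcd_div {x : Fin 3 → ℕ} {j : ℕ} (h : ∀ i, j ∣ x i) :
    tripleGcd (fun i => x i / j) = tripleGcd x / j := by
  unfold tripleGcd
  rw [Nat.gcd_div (h 1) (h 2), Nat.gcd_div (h 0) (Nat.dvd_gcd (h 1) (h 2))]

lemma dvd_tripleGcd {x : Fin 3 → ℕ} {j : ℕ} (h : ∀ i, j ∣ x i) : j ∣ tripleGcd x :=
  Nat.dvd_gcd (h 0) (Nat.dvd_gcd (h 1) (h 2))

/-- The greatest common divisor `j` of a triple, together with the product of the greatest common
divisors of pairs in the triple divided by `j`. -/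
def gcdType (x : Fin 3 → ℕ) : ℕ+ × ℕ+ :=
  ((tripleGcd x).toPNat', (pairGcd fun i => x i / tripleGcd x).toPNat')

lemma div_tripleGcd_ne_zero {x : Fin 3 → ℕ} (hx : ∀ i, x i ≠ 0) (i : Fin 3) :
    x i / tripleGcd x ≠ 0 :=
  (Nat.div_pos (Nat.le_of_dvd (Nat.pos_of_ne_zero (hx i)) (tripleGcd_dvd x i))
    (Nat.pos_of_ne_zero (tripleGcd_ne_zero hx))).ne'

lemma coe_gcdType_fst {x : Fin 3 → ℕ} (hx : ∀ i, x i ≠ 0) :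
    ((gcdType x).1 : ℕ) = tripleGcd x := by
  simp [gcdType, Nat.pos_of_ne_zero (tripleGcd_ne_zero hx)]

lemma coe_gcdType_snd {x : Fin 3 → ℕ} (hx : ∀ i, x i ≠ 0) :
    ((gcdType x).2 : ℕ) = pairGcd fun i => x i / tripleGcd x := by
  simp [gcdType, Nat.pos_of_ne_zero (pairGcd_ne_zero (div_tripleGcd_ne_zero hx))]

lemma gcdType_eq_iff {x : Fin 3 → ℕ} (hx : ∀ i, x i ≠ 0) (k : ℕ+ × ℕ+) :
    gcdType x = k ↔ (∀ i, (k.1 : ℕ) ∣ x i) ∧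
      ∀ p : Nat.Primes, LocalCond p ((k.2 : ℕ).factorization p) (fun i => x i / k.1) := by
  rw [Prod.ext_iff, ← PNat.coe_inj, ← PNat.coe_inj, coe_gcdType_fst hx, coe_gcdType_snd hx]
  have hpos : ∀ h : (∀ i, (k.1 : ℕ) ∣ x i), ∀ i, x i / (k.1 : ℕ) ≠ 0 := fun h i =>
    (Nat.div_pos (Nat.le_of_dvd (Nat.pos_of_ne_zero (hx i)) (h i)) k.1.pos).ne'
  constructor
  · rintro ⟨h1, h2⟩
    have hd : ∀ i, (k.1 : ℕ) ∣ x i := fun i => h1 ▸ tripleGcd_dvd x i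
    refine ⟨hd, (tripleGcd_pairGcd_iff (hpos hd) k.2.ne_zero).1 ⟨?_, ?_⟩⟩
    · rw [tripleGcd_div hd, h1, Nat.div_self k.1.pos]
    · rw [← h1]
      exact h2
  · rintro ⟨hd, h⟩
    obtain ⟨h1, h2⟩ := (tripleGcd_pairGcd_iff (hpos hd) k.2.ne_zero).2 h
    rw [tripleGcd_div hd] at h1
    have h3 : tripleGcd x = k.1 := by
      have := Nat.div_mul_cancel (dvd_tripleGcd hd)
      rw [h1, one_mul] at this
      exact this.symm
    exact ⟨h3, by rw [h3]; exact h2⟩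

/-- Every triple whose type is not among finitely many ones has two coordinates with a large
common divisor. -/
lemma hasLargeCommonDvd_of_gcdType {x : Fin 3 → ℕ} (hx : ∀ i, x i ≠ 0) {R : ℕ}
    (h : R < (gcdType x).1 ∨ R ^ 3 < (gcdType x).2) : HasLargeCommonDvd R x := by
  rw [coe_gcdType_fst hx, coe_gcdType_snd hx] at h
  rcases h with h | h
  · exact ⟨_, h, 0, 1, by decide, tripleGcd_dvd x 0, tripleGcd_dvd x 1⟩
  · have hd : ∀ i, x i / tripleGcd x ∣ x i := fun i => Nat.div_dvd_of_dvd (tripleGcd_dvd x i)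
    by_contra hc
    simp only [HasLargeCommonDvd, not_exists, not_and] at hc
    -- If no pair shares a divisor above `R`, each of the three factors of `pairGcd` is at most `R`;
    -- hence the threshold `R ^ 3`.
    have hle : ∀ i j : Fin 3, i ≠ j →
        Nat.gcd (x i / tripleGcd x) (x j / tripleGcd x) ≤ R := by
      intro i j hij
      by_contra hR
      exact hc _ (not_le.1 hR) i j hij ((Nat.gcd_dvd_left _ _).trans (hd i))
        ((Nat.gcd_dvd_right _ _).trans (hd j))
    have : pairGcd (fun i => x i / tripleGcd x) ≤ R * R * R :=
      Nat.mul_le_mul (Nat.mul_le_mul (hle 0 1 (by decide)) (hle 0 2 (by decide)))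
        (hle 1 2 (by decide))
    exact absurd (this.trans_eq (by ring)) (not_le.2 h)

/-! ### The density of a type as a product over all primes -/

/-- The terms in `1 / p` cancel: the factor is `1 - 3 / p² + 2 / p³`. -/
lemma multipliable_factorT : Multipliable (fun p : Nat.Primes => factorT 3 p) := by
  have hs : Summable fun p : Nat.Primes =>
      ‖-3 / ((p : ℕ) : ℝ) ^ 2 + 2 / ((p : ℕ) : ℝ) ^ 3‖ := by
    have h2 : Summable fun n : ℕ => -3 / (n : ℝ) ^ 2 + 2 / (n : ℝ) ^ 3 := by
      have h3 := (Real.summable_one_div_nat_pow.2 (show 1 < 2 by norm_num)).mul_left (-3)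
      have h4 := (Real.summable_one_div_nat_pow.2 (show 1 < 3 by norm_num)).mul_left 2
      refine (h3.add h4).congr fun n => ?_
      ring
    exact (h2.comp_injective Subtype.val_injective).norm
  refine (multipliable_one_add_of_summable hs).congr fun p => ?_
  have hp : ((p : ℕ) : ℝ) ≠ 0 := by exact_mod_cast p.2.ne_zero
  rw [factorT, show 3 - 1 = 2 from rfl]
  push_cast
  field_simp
  ring

/-- Extracting the factor of `T_3` at every prime leaves 1 away from `m`, so the rest is a finite
product over the prime divisors of `m`. -/
lemma localDensity_eq (p : ℕ) (hp : p.Prime) (e : ℕ) :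
    localDensity p e = factorT 3 p * if e = 0 then 1 else
      (1 + (((3 : ℕ) : ℝ) - 2) / (p : ℝ)) / (1 + (((3 : ℕ) : ℝ) - 1) / (p : ℝ)) * 3 *
        (((p : ℝ) ^ e) ^ 2)⁻¹ := by
  have hp0 : (0 : ℝ) < p := by exact_mod_cast hp.pos
  unfold localDensity
  split_ifs with he
  · rw [mul_one]
  · rw [factorT, show 3 - 1 = 2 from rfl]
    push_cast
    have h1 : (p : ℝ) + 2 ≠ 0 := by positivity
    have h2 : (p : ℝ) + (3 - 1) ≠ 0 := by norm_num; positivity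
    field_simp
    ring

/-- The product of the local densities belonging to an integer `m`. -/
lemma prod_localDensity {m : ℕ} (hm : m ≠ 0) (S : Finset Nat.Primes)
    (hS : ∀ p : Nat.Primes, (p : ℕ) ∣ m → p ∈ S) :
    ∏ p ∈ S, localDensity p (m.factorization p) =
      (∏ p ∈ S, factorT 3 p) * (coeffJ m / (m : ℝ) ^ 2) := by
  rw [Finset.prod_congr rfl fun (p : Nat.Primes) _ => localDensity_eq p p.2 _, Finset.prod_mul_distrib]
  congr 1
  refine (Finset.prod_map S (⟨fun p : Nat.Primes => (p : ℕ), Subtype.val_injective⟩)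
    fun p : ℕ => if m.factorization p = 0 then (1 : ℝ) else
      (1 + (((3 : ℕ) : ℝ) - 2) / (p : ℝ)) / (1 + (((3 : ℕ) : ℝ) - 1) / (p : ℝ)) * 3 *
        (((p : ℝ) ^ m.factorization p) ^ 2)⁻¹).symm.trans ?_
  have hsub : m.primeFactors ⊆
      S.map ⟨fun p : Nat.Primes => (p : ℕ), Subtype.val_injective⟩ := by
    intro p hp
    have h := Nat.mem_primeFactors.1 hp
    exact Finset.mem_map.2 ⟨⟨p, h.1⟩, hS ⟨p, h.1⟩ h.2.1, rfl⟩
  -- Primes of `S` not dividing `m` contribute 1.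
  rw [← Finset.prod_subset hsub fun p _ hp => by
    rw [if_pos]
    rwa [← Finsupp.notMem_support_iff, Nat.support_factorization]]
  rw [Finset.prod_congr rfl fun p hp => by
    rw [if_neg]
    rwa [← Nat.support_factorization, Finsupp.mem_support_iff] at hp]
  rw [Finset.prod_mul_distrib, Finset.prod_mul_distrib, Finset.prod_const, Finset.prod_inv_distrib,
    Finset.prod_pow, coeffJ, upsilon, div_eq_mul_inv,
    ArithmeticFunction.cardDistinctFactors_apply, ← List.card_toFinset, ← Nat.primeFactors]
  congr 4
  conv_rhs => rw [← Nat.prod_factorization_pow_eq_self hm]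
  rw [Finsupp.prod, Nat.support_factorization]
  push_cast
  rfl

/-- The asymptotic density of the triples of a given type. -/
noncomputable def typeDensity (k : ℕ+ × ℕ+) : ℝ :=
  constT 3 * (coeffJ k.2 / (k.2 : ℝ) ^ 2) / (k.1 : ℝ) ^ 3

/-- Once `S` contains the primes dividing `k.2`, the product is a partial product of `T_3` times a
constant. -/
lemma tendsto_typeDensity (k : ℕ+ × ℕ+) :
    Tendsto (fun S : Finset Nat.Primes =>
      (∏ p ∈ S, localDensity p ((k.2 : ℕ).factorization p)) / (k.1 : ℝ) ^ 3) atTop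
      (𝓝 (typeDensity k)) := by
  have h : Tendsto (fun S : Finset Nat.Primes => ∏ p ∈ S, factorT 3 p) atTop (𝓝 (constT 3)) := by
    have := multipliable_factorT.hasProd
    rwa [HasProd, SummationFilter.unconditional_filter] at this
  refine ((h.mul_const (coeffJ k.2 / (k.2 : ℝ) ^ 2)).div_const _).congr' ?_
  have hfin : Set.Finite {p : Nat.Primes | (p : ℕ) ∣ (k.2 : ℕ)} := by
    refine Set.Finite.of_finite_image ((Finset.finite_toSet (k.2 : ℕ).divisors).subset ?_)
      (f := fun p : Nat.Primes => (p : ℕ)) Subtype.val_injective.injOn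
    rintro _ ⟨p, hp, rfl⟩
    simpa using hp
  filter_upwards [eventually_ge_atTop hfin.toFinset] with S hS
  rw [prod_localDensity k.2.ne_zero S fun p hp => hS (by simpa using hp)]

/-! ### Equidistribution over types and summation over all types -/

/-- The triples subject to finitely many local conditions approximate those of a given type. -/
lemma MonoWeight.abs_sum_sub_le {w : ℕ → (Fin 3 → ℕ) → ℝ} (hw : MonoWeight w) (k : ℕ+ × ℕ+)
    {R : ℕ} (hR : 0 < R) {S : Finset Nat.Primes}
    (hS : ∀ p : Nat.Primes, (p : ℕ) ∣ k.2 ∨ (p : ℕ) ≤ R → p ∈ S)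
    (A : (Fin 3 → ℕ) → Prop) [DecidablePred A]
    (hA : ∀ x, A x ↔ (∀ i, (k.1 : ℕ) ∣ x i) ∧
      ∀ p ∈ S, LocalCond p ((k.2 : ℕ).factorization p) (fun i => x i / k.1)) (n : ℕ) :
    |∑ x ∈ (box n).filter (fun x => gcdType x = k), w n x - ∑ x ∈ (box n).filter A, w n x| ≤
      6 / R * (n : ℝ) ^ 3 := by
  classical
  have hne : ∀ x ∈ box n, ∀ i, x i ≠ 0 := fun x hx i =>
    (Nat.lt_of_lt_of_le Nat.zero_lt_one (mem_box.1 hx i).1).ne'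
  have hsub : (box n).filter (fun x => gcdType x = k) ⊆ (box n).filter A := by
    intro x hx
    rw [Finset.mem_filter] at hx ⊢
    have h := (gcdType_eq_iff (hne x hx.1) k).1 hx.2
    exact ⟨hx.1, (hA x).2 ⟨h.1, fun p _ => h.2 p⟩⟩
  rw [abs_sub_comm, ← Finset.sum_sdiff hsub, add_sub_cancel_right, abs_of_nonneg
    (Finset.sum_nonneg fun x hx => hw.nonneg n x
      (Finset.mem_filter.1 (Finset.mem_sdiff.1 hx).1).1)]
  refine le_trans ?_ (card_box_large_common_dvd_le n R hR)
  refine (Finset.sum_le_card_nsmul _ _ 1 fun x hx => hw.le_one n x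
      (Finset.mem_filter.1 (Finset.mem_sdiff.1 hx).1).1).trans ?_
  rw [nsmul_one, Nat.cast_le]
  refine Finset.card_le_card fun x hx => ?_
  simp only [Finset.mem_sdiff, Finset.mem_filter, not_and] at hx ⊢
  obtain ⟨⟨hx, hAx⟩, hx'⟩ := hx
  refine ⟨hx, ?_⟩
  obtain ⟨hd, hloc⟩ := (hA x).1 hAx
  have hk := hx' hx
  rw [gcdType_eq_iff (hne x hx) k] at hk
  simp only [not_and, not_forall] at hk
  obtain ⟨p, hp⟩ := hk hd
  have hpS : p ∉ S := fun h => hp (hloc p h)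
  have hpm : ¬ (p : ℕ) ∣ k.2 := fun h => hpS (hS p (Or.inl h))
  have hpR : R < p := not_le.1 fun h => hpS (hS p (Or.inr h))
  -- The failing prime lies outside `S`, so it exceeds `R` and has prescribed exponent 0. Failure
  -- then means that it divides two coordinates.
  rw [Nat.factorization_eq_zero_of_not_dvd hpm] at hp
  refine ⟨p, hpR, ?_⟩
  by_contra hc
  simp only [not_exists, not_and] at hc
  have hdiv : ∀ i, (p : ℕ) ∣ x i / k.1 → (p : ℕ) ∣ x i := fun i h =>
    h.trans (Nat.div_dvd_of_dvd (hd i))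
  have hc' : ∀ i j, i ≠ j → (p : ℕ) ∣ x i / k.1 → ¬ (p : ℕ) ∣ x j / k.1 := fun i j hij hi hj =>
    hc i j hij (hdiv i hi) (hdiv j hj)
  apply hp
  unfold LocalCond
  simp only [pow_zero, isUnit_one, IsUnit.dvd, implies_true, true_and, zero_add, pow_one]
  by_cases h0 : (p : ℕ) ∣ x 0 / k.1
  · exact ⟨1, hc' 0 1 (by decide) h0, 2, by decide, hc' 0 2 (by decide) h0⟩
  · by_cases h1 : (p : ℕ) ∣ x 1 / k.1
    · exact ⟨0, h0, 2, by decide, hc' 1 2 (by decide) h1⟩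
    · exact ⟨0, h0, 1, by decide, h1⟩

/-- Equidistribution of a monotone weight over the triples of a given type. -/
lemma MonoWeight.tendsto_gcdType {w : ℕ → (Fin 3 → ℕ) → ℝ} (hw : MonoWeight w) {I : ℝ}
    (hI : Tendsto (fun n : ℕ => (∑ x ∈ box n, w n x) / (n : ℝ) ^ 3) atTop (𝓝 I))
    (k : ℕ+ × ℕ+) :
    Tendsto (fun n : ℕ => (∑ x ∈ (box n).filter (fun x => gcdType x = k), w n x) / (n : ℝ) ^ 3)
      atTop (𝓝 (typeDensity k * I)) := by
  classical
  rw [Metric.tendsto_nhds]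
  intro ε hε
  obtain ⟨R, hR⟩ := exists_nat_gt (6 / (ε / 3))
  have hR0 : 0 < R := by
    have : (0 : ℝ) < R := lt_trans (by positivity) hR
    exact_mod_cast this
  have hRε : 6 / (R : ℝ) < ε / 3 := by
    rw [div_lt_comm₀ (by exact_mod_cast hR0) (by positivity)]
    exact hR
  have hfin : Set.Finite {p : Nat.Primes | (p : ℕ) ∣ (k.2 : ℕ) ∨ (p : ℕ) ≤ R} := by
    refine Set.Finite.of_finite_image ((Set.finite_Iic (max (k.2 : ℕ) R)).subset ?_)
      (f := fun p : Nat.Primes => (p : ℕ)) Subtype.val_injective.injOn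
    rintro _ ⟨p, hp | hp, rfl⟩
    · exact le_max_of_le_left (Nat.le_of_dvd k.2.pos hp)
    · exact le_max_of_le_right hp
  have hlim := (tendsto_typeDensity k).mul_const I
  rw [Metric.tendsto_nhds] at hlim
  -- `S` is fixed before `n`: the error from ignoring the other primes is at most `6 / R` uniformly
  -- in `n`.
  obtain ⟨S, hS1, hS2⟩ := ((hlim (ε / 3) (by positivity)).and
    (eventually_ge_atTop hfin.toFinset)).exists
  obtain ⟨B, hB, hBc⟩ := exists_residues S fun p => (k.2 : ℕ).factorization p
  have : NeZero (k.1 : ℕ) := ⟨k.1.ne_zero⟩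
  have hper := hw.tendsto_periodic hI k.1 _ B
  rw [hBc, Metric.tendsto_nhds] at hper
  filter_upwards [hper (ε / 3) (by positivity), eventually_gt_atTop 0] with n hn hn0
  have hn3 : (0 : ℝ) < (n : ℝ) ^ 3 := by positivity
  have happ := hw.abs_sum_sub_le k hR0 (S := S) (fun p hp => hS2 (by simpa using hp))
    (fun x => (∀ i, (k.1 : ℕ) ∣ x i) ∧ residue _ (fun i => x i / k.1) ∈ B)
    (fun x => by rw [hB]) n
  rw [← div_le_iff₀ hn3, ← abs_of_pos hn3, ← abs_div, sub_div,
    ← Real.dist_eq] at happ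
  have h1 := (dist_triangle _ _ _).trans_lt (add_lt_add (happ.trans_lt hRε) hn)
  have h2 := (dist_triangle _ _ _).trans_lt (add_lt_add h1 hS1)
  exact h2.trans_eq (by ring)

/-- Triples of finitely many types exhaust the boxes up to a small proportion. -/
lemma abs_sum_box_sub_sum_types_le {v : ℕ+ × ℕ+ → (Fin 3 → ℕ) → ℝ} {n R : ℕ} (hR : 0 < R)
    (h0 : ∀ k, ∀ x ∈ box n, 0 ≤ v k x) (h1 : ∀ k, ∀ x ∈ box n, v k x ≤ 1)
    {F : Finset (ℕ+ × ℕ+)} (hF : ∀ k : ℕ+ × ℕ+, (k.1 : ℕ) ≤ R → (k.2 : ℕ) ≤ R ^ 3 → k ∈ F) :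
    |∑ x ∈ box n, v (gcdType x) x -
      ∑ k ∈ F, ∑ x ∈ (box n).filter (fun x => gcdType x = k), v k x| ≤ 6 / R * (n : ℝ) ^ 3 := by
  classical
  have hfib : ∑ k ∈ F, ∑ x ∈ (box n).filter (fun x => gcdType x = k), v k x =
      ∑ x ∈ (box n).filter (fun x => gcdType x ∈ F), v (gcdType x) x := by
    rw [← Finset.sum_fiberwise_of_maps_to (s := (box n).filter fun x => gcdType x ∈ F) (t := F)
      (g := gcdType) fun x hx => (Finset.mem_filter.1 hx).2]
    refine Finset.sum_congr rfl fun k hk => ?_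
    rw [Finset.filter_filter]
    refine Finset.sum_congr ?_ fun x hx => by rw [(Finset.mem_filter.1 hx).2.2]
    ext x
    simp only [Finset.mem_filter, and_congr_right_iff]
    rintro -
    exact ⟨fun h => ⟨h ▸ hk, h⟩, fun h => h.2⟩
  rw [hfib, ← Finset.sum_filter_add_sum_filter_not (box n) (fun x => gcdType x ∈ F),
    add_sub_cancel_left, abs_of_nonneg (Finset.sum_nonneg fun x hx =>
      h0 _ x (Finset.mem_filter.1 hx).1)]
  refine le_trans ?_ (card_box_large_common_dvd_le n R hR)
  refine (Finset.sum_le_card_nsmul _ _ 1 fun x hx => h1 _ x (Finset.mem_filter.1 hx).1).trans ?_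
  rw [nsmul_one, Nat.cast_le]
  refine Finset.card_le_card fun x hx => ?_
  rw [Finset.mem_filter] at hx ⊢
  refine ⟨hx.1, hasLargeCommonDvd_of_gcdType
    (fun i => (Nat.lt_of_lt_of_le Nat.zero_lt_one (mem_box.1 hx.1 i).1).ne') ?_⟩
  by_contra hc
  rw [not_or, not_lt, not_lt] at hc
  exact hx.2 (hF _ hc.1 hc.2)

/-- Equidistribution of monotone weights depending on the type of a triple. -/
lemma tendsto_sum_gcdType {G : ℕ+ × ℕ+ → ℕ → (Fin 3 → ℕ) → ℝ} (hG : ∀ k, MonoWeight (G k))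
    {I : ℕ+ × ℕ+ → ℝ}
    (hI : ∀ k, Tendsto (fun n : ℕ => (∑ x ∈ box n, G k n x) / (n : ℝ) ^ 3) atTop (𝓝 (I k))) :
    Summable (fun k => typeDensity k * I k) ∧
      Tendsto (fun n : ℕ => (∑ x ∈ box n, G (gcdType x) n x) / (n : ℝ) ^ 3) atTop
        (𝓝 (∑' k, typeDensity k * I k)) := by
  classical
  have hk := fun k => (hG k).tendsto_gcdType (hI k) k
  have hFlim := fun F : Finset (ℕ+ × ℕ+) => tendsto_finsetSum F fun k (_ : k ∈ F) => hk k
  -- Each term is a limit of nonnegative averages, and the averages over disjoint types add up to at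
  -- most 1. This gives summability with no estimate of the coefficients.
  have hnn : ∀ k, 0 ≤ typeDensity k * I k := fun k =>
    ge_of_tendsto' (hk k) fun n => div_nonneg (Finset.sum_nonneg fun x hx =>
      (hG k).nonneg n x (Finset.mem_filter.1 hx).1) (by positivity)
  have hsum : Summable (fun k => typeDensity k * I k) := by
    refine summable_of_sum_le hnn (c := 1) fun F => le_of_tendsto' (hFlim F) fun n => ?_
    rw [← Finset.sum_div]
    refine div_le_one_of_le₀ ?_ (by positivity)
    calc ∑ k ∈ F, ∑ x ∈ (box n).filter (fun x => gcdType x = k), G k n x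
        ≤ ∑ k ∈ F, (((box n).filter (fun x => gcdType x = k)).card : ℝ) := by
          refine Finset.sum_le_sum fun k _ => ?_
          refine (Finset.sum_le_card_nsmul _ _ 1 fun x hx =>
            (hG k).le_one n x (Finset.mem_filter.1 hx).1).trans_eq (nsmul_one _)
      _ ≤ ((box n).card : ℝ) := by
          rw [← Nat.cast_sum, Nat.cast_le,
            ← Finset.card_biUnion (fun k _ l _ hkl => by
              rw [Function.onFun, Finset.disjoint_left]
              intro x hx hy
              exact hkl ((Finset.mem_filter.1 hx).2.symm.trans (Finset.mem_filter.1 hy).2))]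
          exact Finset.card_le_card (Finset.biUnion_subset.2 fun k _ => Finset.filter_subset _ _)
      _ = (n : ℝ) ^ 3 := by rw [card_box]; push_cast; rfl
  refine ⟨hsum, ?_⟩
  rw [Metric.tendsto_nhds]
  intro ε hε
  obtain ⟨R, hR⟩ := exists_nat_gt (6 / (ε / 3))
  have hR0 : 0 < R := by
    have : (0 : ℝ) < R := lt_trans (by positivity) hR
    exact_mod_cast this
  have hRε : 6 / (R : ℝ) < ε / 3 := by
    rw [div_lt_comm₀ (by exact_mod_cast hR0) (by positivity)]
    exact hR
  have hlim := hsum.hasSum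
  rw [HasSum, SummationFilter.unconditional_filter, Metric.tendsto_nhds] at hlim
  -- Since `R > 0`, `toPNat'` keeps the values `R` and `R ^ 3` instead of defaulting to 1.
  obtain ⟨F, hF1, hF2⟩ := ((hlim (ε / 3) (by positivity)).and (eventually_ge_atTop
    (Finset.Iic (R.toPNat', (R ^ 3).toPNat')))).exists
  have hF : ∀ k : ℕ+ × ℕ+, (k.1 : ℕ) ≤ R → (k.2 : ℕ) ≤ R ^ 3 → k ∈ F := by
    intro k h1 h2
    refine hF2 (Finset.mem_Iic.2 ⟨?_, ?_⟩)
    · rw [← PNat.coe_le_coe, Nat.toPNat'_coe, if_pos hR0]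
      exact h1
    · rw [← PNat.coe_le_coe, Nat.toPNat'_coe, if_pos (pow_pos hR0 3)]
      exact h2
  have hFl := hFlim F
  rw [Metric.tendsto_nhds] at hFl
  filter_upwards [hFl (ε / 3) (by positivity), eventually_gt_atTop 0] with n hn hn0
  have hn3 : (0 : ℝ) < (n : ℝ) ^ 3 := by positivity
  have happ := abs_sum_box_sub_sum_types_le (v := fun k => G k n) hR0
    (fun k => (hG k).nonneg n) (fun k => (hG k).le_one n) hF
  rw [← div_le_iff₀ hn3, ← abs_of_pos hn3, ← abs_div, sub_div,
    ← Real.dist_eq] at happ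
  rw [← Finset.sum_div] at hn
  have h1 := (dist_triangle _ _ _).trans_lt (add_lt_add (happ.trans_lt hRε) hn)
  have h2 := (dist_triangle _ _ _).trans_lt (add_lt_add h1 hF1)
  exact h2.trans_eq (by ring)

lemma tendsto_card_box_div : Tendsto (fun n : ℕ => (∑ _x ∈ box n, (1 : ℝ)) / (n : ℝ) ^ 3) atTop
    (𝓝 1) := by
  refine tendsto_const_nhds.congr' ?_
  filter_upwards [eventually_gt_atTop 0] with n hn
  have hn3 : (n : ℝ) ^ 3 ≠ 0 := by positivity
  rw [Finset.sum_const, nsmul_one, card_box, Nat.cast_pow, div_self hn3]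

/-- The constant weight 1: no mass escapes to infinitely many types. -/
lemma tsum_typeDensity : ∑' k, typeDensity k = 1 := by
  have h := (tendsto_sum_gcdType (G := fun _ _ _ => 1) (I := fun _ => 1)
    (fun _ => ⟨fun _ _ _ => zero_le_one, fun _ _ _ => le_rfl, fun _ => monotone_const⟩)
    fun _ => tendsto_card_box_div).2
  simpa using tendsto_nhds_unique h tendsto_card_box_div

/-- Densities with total mass 1 cannot all vanish. This allows `T_3` to be divided out of the
summability statements. -/
lemma constT_three_ne_zero : constT 3 ≠ 0 := by
  intro h
  have := tsum_typeDensity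
  simp [typeDensity, h] at this

/-! ### The least common multiple in terms of the type -/

/-- At each prime the sorted exponents are `0 ≤ b ≤ c`; the lcm has `c`, the product of pair gcds
has `b`. -/
lemma lcm_mul_pairGcd {y : Fin 3 → ℕ} (hy : ∀ i, y i ≠ 0) (hy1 : tripleGcd y = 1) :
    Nat.lcm (y 0) (Nat.lcm (y 1) (y 2)) * pairGcd y = y 0 * y 1 * y 2 := by
  have h0 := hy 0
  have h1 := hy 1
  have h2 := hy 2
  have h12 := Nat.lcm_ne_zero h1 h2
  refine Nat.eq_of_factorization_eq
    (mul_ne_zero (Nat.lcm_ne_zero h0 h12) (pairGcd_ne_zero hy))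
    (mul_ne_zero (mul_ne_zero h0 h1) h2) fun p => ?_
  have hmin : (tripleGcd y).factorization p = 0 := by simp [hy1]
  unfold tripleGcd at hmin
  have hpg := pairGcd_ne_zero hy
  unfold pairGcd at hpg ⊢
  rw [Nat.factorization_gcd h0 (Nat.gcd_ne_zero_left h1), Nat.factorization_gcd h1 h2] at hmin
  rw [Nat.factorization_mul (Nat.lcm_ne_zero h0 h12) hpg,
    Nat.factorization_mul (mul_ne_zero (Nat.gcd_ne_zero_left h0) (Nat.gcd_ne_zero_left h0))
    (Nat.gcd_ne_zero_left h1), Nat.factorization_mul (Nat.gcd_ne_zero_left h0)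
    (Nat.gcd_ne_zero_left h0), Nat.factorization_gcd h1 h2, Nat.factorization_gcd h0 h1,
    Nat.factorization_gcd h0 h2, Nat.factorization_lcm h0 h12, Nat.factorization_lcm h1 h2,
    Nat.factorization_mul (mul_ne_zero h0 h1) h2, Nat.factorization_mul h0 h1]
  simp only [Finsupp.coe_add, Pi.add_apply, Finsupp.inf_apply, Finsupp.sup_apply] at hmin ⊢
  omega

/-- The type of a triple determines the ratio of its product and its least common multiple. -/
lemma lcmTriple_mul_gcdType {x : Fin 3 → ℕ} (hx : ∀ i, x i ≠ 0) :
    lcmTriple x * (((gcdType x).1 : ℕ) ^ 2 * (gcdType x).2) = ∏ i, x i := by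
  rw [coe_gcdType_fst hx, coe_gcdType_snd hx]
  set g := tripleGcd x with hg
  have hy := div_tripleGcd_ne_zero hx
  rw [← hg] at hy
  set y : Fin 3 → ℕ := fun i => x i / g with hydef
  have hxy : ∀ i, x i = g * y i := fun i => (Nat.mul_div_cancel' (tripleGcd_dvd x i)).symm
  have hy1 : tripleGcd y = 1 := by
    rw [hydef, hg, tripleGcd_div (tripleGcd_dvd x),
      Nat.div_self (Nat.pos_of_ne_zero (tripleGcd_ne_zero hx))]
  have hl : lcmTriple x = Nat.lcm (x 0) (Nat.lcm (x 1) (x 2)) := by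
    simp [lcmTriple, Fin.univ_succ, lcm_eq_nat_lcm, Finset.lcm_insert]
  have key : Nat.lcm (y 0) (Nat.lcm (y 1) (y 2)) * pairGcd y = y 0 * y 1 * y 2 :=
    lcm_mul_pairGcd hy hy1
  -- The lcm scales by `g` and the product by `g ^ 3`, which accounts for the square of the gcd.
  rw [hl, Fin.prod_univ_three, hxy 0, hxy 1, hxy 2, Nat.lcm_mul_left, Nat.lcm_mul_left]
  calc _ = g ^ 3 * (Nat.lcm (y 0) (Nat.lcm (y 1) (y 2)) * pairGcd y) := by ring
    _ = _ := by rw [key]; ring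

/-! ### Mean values of the weights: lattice points and power sums -/

open Classical Pointwise in
lemma card_lattice_inter (s : Set (Fin 3 → ℝ)) (hs : ∀ y ∈ s, ∀ i, 0 < y i ∧ y i ≤ 1)
    {n : ℕ} (hn : 0 < n) :
    Nat.card ↑(s ∩ (n : ℝ)⁻¹ • (Submodule.span ℤ (Set.range (Pi.basisFun ℝ (Fin 3))) :
      Set (Fin 3 → ℝ))) =
      ((box n).filter fun x => (fun i => (x i : ℝ) / n) ∈ s).card := by
  have hn' : (0 : ℝ) < n := by exact_mod_cast hn
  have himg : s ∩ (n : ℝ)⁻¹ • (Submodule.span ℤ (Set.range (Pi.basisFun ℝ (Fin 3))) :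
      Set (Fin 3 → ℝ)) = (fun (x : Fin 3 → ℕ) i => (x i : ℝ) / n) ''
        ((box n).filter fun x => (fun i => (x i : ℝ) / n) ∈ s : Finset (Fin 3 → ℕ)) := by
    ext y
    rw [Set.mem_inter_iff, Set.mem_smul_set_iff_inv_smul_mem₀ (inv_ne_zero hn'.ne'), inv_inv,
      SetLike.mem_coe, (Pi.basisFun ℝ (Fin 3)).mem_span_iff_repr_mem ℤ]
    simp only [Pi.basisFun_repr, Pi.smul_apply, smul_eq_mul, Set.mem_range, Set.mem_image,
      Finset.coe_filter, mem_box]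
    constructor
    · rintro ⟨hy, hz⟩
      choose z hz using hz
      have hz' : ∀ i, (z i : ℝ) = n * y i := fun i => by simpa using hz i
      have hpos : ∀ i, 1 ≤ z i ∧ z i ≤ n := by
        intro i
        obtain ⟨h1, h2⟩ := hs y hy i
        constructor
        · have : (0 : ℝ) < z i := by rw [hz']; positivity
          exact_mod_cast this
        · have : (z i : ℝ) ≤ n := by rw [hz']; nlinarith
          exact_mod_cast this
      have hcast : ∀ i, (((z i).toNat : ℕ) : ℝ) = z i := by
        intro i
        have : (((z i).toNat : ℕ) : ℤ) = z i := Int.toNat_of_nonneg (by have := hpos i; omega)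
        exact_mod_cast this
      have hyeq : (fun i => (((z i).toNat : ℕ) : ℝ) / n) = y := by
        funext i
        rw [hcast, hz', mul_div_cancel_left₀ _ hn'.ne']
      refine ⟨fun i => (z i).toNat, ⟨fun i => ?_, ?_⟩, hyeq⟩
      · have := hpos i
        dsimp only
        omega
      · rw [hyeq]
        exact hy
    · rintro ⟨x, ⟨-, hx⟩, rfl⟩
      exact ⟨hx, fun i => ⟨x i, by simp [mul_div_cancel₀ _ hn'.ne']⟩⟩
  rw [himg, Nat.card_image_of_injective, Nat.card_coe_set_eq, Set.ncard_coe_finset]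
  intro x x' h
  funext i
  have := congrFun h i
  simp only at this
  rw [div_left_inj' hn'.ne'] at this
  exact_mod_cast this

/-- After scaling by `1 / n` the triples are the lattice points of a bounded region in `(0, 1]^3`.
Omitting the faces at 0, which are null sets, matches the coordinates starting at 1. -/
lemma tendsto_card_prod_le (c : ℝ) :
    Tendsto (fun n : ℕ => (((box n).filter
      fun x => ((∏ i, x i : ℕ) : ℝ) ≤ c * (n : ℝ) ^ 3).card : ℝ) / (n : ℝ) ^ 3) atTop
      (𝓝 (volOmega 3 c)) := by
  set s : Set (Fin 3 → ℝ) := {y | (∀ i, 0 < y i ∧ y i ≤ 1) ∧ ∏ i, y i ≤ c} with hs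
  have hsub : s ⊆ Set.Icc 0 1 := fun y hy =>
    ⟨fun i => (hy.1 i).1.le, fun i => (hy.1 i).2⟩
  have hset : s = (Set.univ.pi fun _ => Set.Ioc 0 1) ∩ {y | ∏ i, y i ≤ c} := by
    ext y
    simp [hs, Set.mem_pi]
  have hmeas : MeasurableSet s := by
    rw [hset]
    exact (MeasurableSet.univ_pi fun _ => measurableSet_Ioc).inter
      (measurableSet_le (by fun_prop) measurable_const)
  -- Order-connected sets have null frontier, which the lattice point count requires.
  have hord : s.OrdConnected := by
    refine ⟨fun x hx y hy z hz => ⟨fun i => ⟨(hx.1 i).1.trans_le (hz.1 i),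
      (hz.2 i).trans (hy.1 i).2⟩, le_trans ?_ hy.2⟩⟩
    exact Finset.prod_le_prod (fun i _ => ((hx.1 i).1.trans_le (hz.1 i)).le) fun i _ => hz.2 i
  have hvol : volume.real s = volOmega 3 c := by
    refine measureReal_congr ?_
    have hreg : regionA 3 c = Set.Icc 0 1 ∩ {y | ∏ i, y i ≤ c} := by
      ext y
      simp [regionA, Pi.le_def, forall_and]
    rw [hset, hreg]
    exact (Measure.univ_pi_Ioc_ae_eq_Icc (f := fun _ => (0 : ℝ)) (g := fun _ => 1)).inter
      (ae_eq_refl _)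
  have h := tendsto_card_div_pow_atTop_volume s ((Metric.isBounded_Icc 0 1).subset hsub) hmeas
    hord.null_frontier
  rw [hvol] at h
  refine h.congr' ?_
  filter_upwards [eventually_gt_atTop 0] with n hn
  have hn' : (0 : ℝ) < n := by exact_mod_cast hn
  rw [card_lattice_inter s (fun y hy => hy.1) hn, Fintype.card_fin]
  congr 3
  ext x
  simp only [Finset.mem_filter, and_congr_right_iff]
  intro hx
  rw [mem_box] at hx
  have h1 : ∏ i, (x i : ℝ) / n = ((∏ i, x i : ℕ) : ℝ) / (n : ℝ) ^ 3 := by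
    rw [Finset.prod_div_distrib]
    simp
  simp only [hs, Set.mem_ofPred_eq]
  rw [h1, div_le_iff₀ (by positivity)]
  refine ⟨fun h => h.2, fun h => ⟨fun i => ⟨?_, ?_⟩, h⟩⟩
  · have : 0 < x i := (hx i).1
    positivity
  · rw [div_le_one hn']
    exact_mod_cast (hx i).2

/-- Comparison with the integral of `x ^ q` over `[0, n]`, the upper bound exceeding it by the last
term `n ^ q`. -/
lemma tendsto_sum_Icc_pow (q : ℕ) :
    Tendsto (fun n : ℕ => (∑ k ∈ Finset.Icc 1 n, (k : ℝ) ^ q) / (n : ℝ) ^ (q + 1)) atTop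
      (𝓝 (1 / ((q : ℝ) + 1))) := by
  have hmono : ∀ n : ℕ, MonotoneOn (fun x : ℝ => x ^ q) (Set.Icc 0 (0 + n)) := fun n x hx y _ hxy =>
    pow_le_pow_left₀ hx.1 hxy q
  have hint : ∀ n : ℕ, ∫ x in (0 : ℝ)..0 + n, x ^ q = (n : ℝ) ^ (q + 1) / (q + 1) := by
    intro n
    rw [integral_pow]
    simp
  have hsum : ∀ n : ℕ, ∑ k ∈ Finset.Icc 1 n, (k : ℝ) ^ q =
      ∑ i ∈ Finset.range n, ((0 : ℝ) + ((i + 1 : ℕ) : ℝ)) ^ q := by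
    intro n
    rw [Finset.range_eq_Ico, Finset.sum_Ico_add' (fun i : ℕ => ((0 : ℝ) + (i : ℝ)) ^ q) 0 n 1]
    simp only [zero_add]
    rfl
  have hlow : ∀ n : ℕ, (n : ℝ) ^ (q + 1) / (q + 1) ≤ ∑ k ∈ Finset.Icc 1 n, (k : ℝ) ^ q := by
    intro n
    rw [hsum, ← hint]
    exact (hmono n).integral_le_sum
  have hupp : ∀ n : ℕ, ∑ k ∈ Finset.Icc 1 n, (k : ℝ) ^ q ≤
      (n : ℝ) ^ (q + 1) / (q + 1) + (n : ℝ) ^ q := by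
    intro n
    have h1 := (hmono n).sum_le_integral
    rw [hint] at h1
    have h2 := Finset.sum_range_succ (fun i : ℕ => ((0 : ℝ) + (i : ℝ)) ^ q) n
    rw [Finset.sum_range_succ'] at h2
    rw [hsum]
    simp only [zero_add] at h1 h2 ⊢
    have h3 : (0 : ℝ) ≤ ((0 : ℕ) : ℝ) ^ q := by positivity
    linarith
  have hlim : Tendsto (fun n : ℕ => 1 / ((q : ℝ) + 1) + 1 / (n : ℝ)) atTop
      (𝓝 (1 / ((q : ℝ) + 1))) := by
    simpa using tendsto_const_nhds.add (tendsto_const_div_atTop_nhds_zero_nat (1 : ℝ))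
  refine tendsto_of_tendsto_of_tendsto_of_le_of_le' tendsto_const_nhds hlim ?_ ?_
  · filter_upwards [eventually_gt_atTop 0] with n hn
    have hn' : (0 : ℝ) < n := by exact_mod_cast hn
    rw [le_div_iff₀ (by positivity)]
    exact (le_of_eq (by ring)).trans (hlow n)
  · filter_upwards [eventually_gt_atTop 0] with n hn
    have hn' : (0 : ℝ) < n := by exact_mod_cast hn
    rw [div_le_iff₀ (by positivity)]
    refine (hupp n).trans (le_of_eq ?_)
    field_simp
    ring

/-- The sum over the box factors as the cube of a one-dimensional power sum. -/
lemma tendsto_sum_prod_pow (q : ℕ) :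
    Tendsto (fun n : ℕ => (∑ x ∈ box n, (((∏ i, x i : ℕ) : ℝ) / (n : ℝ) ^ 3) ^ q) / (n : ℝ) ^ 3)
      atTop (𝓝 (1 / ((q : ℝ) + 1) ^ 3)) := by
  have h := (tendsto_sum_Icc_pow q).pow 3
  rw [div_pow, one_pow] at h
  refine h.congr fun n => ?_
  have : ∑ x ∈ box n, ((∏ i, x i : ℕ) : ℝ) ^ q = (∑ k ∈ Finset.Icc 1 n, (k : ℝ) ^ q) ^ 3 := by
    have h1 := Finset.prod_univ_sum (fun _ : Fin 3 => Finset.Icc 1 n) fun _ k => (k : ℝ) ^ q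
    rw [Finset.prod_const, Finset.card_univ, Fintype.card_fin] at h1
    rw [h1]
    refine Finset.sum_congr rfl fun x _ => ?_
    rw [Nat.cast_prod, Finset.prod_pow]
  simp only [div_pow, ← Finset.sum_div, this]
  rw [div_div]
  congr 1
  ring

/-! ### From independent uniform variables to averages over the box -/

lemma pi_uniformOn_real_singleton {n : ℕ} {x : Fin 3 → ℕ} (hx : x ∈ box n) :
    (Measure.pi fun _ : Fin 3 => uniformOn (Set.Icc 1 n : Set ℕ)).real {x} = 1 / (n : ℝ) ^ 3 := by
  have hn : 1 ≤ n := (mem_box.1 hx 0).1.trans (mem_box.1 hx 0).2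
  have := isProbabilityMeasure_uniformOn (Set.finite_Icc 1 n) ⟨1, le_rfl, hn⟩
  have h1 : ∀ i, uniformOn (Set.Icc 1 n : Set ℕ) {x i} = (n : ENNReal)⁻¹ := by
    intro i
    have h := uniformOn_apply_finset (s := Finset.Icc 1 n) (t := {x i})
    rw [Finset.inter_singleton_of_mem (Finset.mem_Icc.2 (mem_box.1 hx i))] at h
    simpa using h
  rw [measureReal_def, Measure.pi_singleton]
  simp [h1]

lemma integral_pi_uniformOn {n : ℕ} (hn : 1 ≤ n) (f : (Fin 3 → ℕ) → ℝ) :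
    ∫ x, f x ∂(Measure.pi fun _ : Fin 3 => uniformOn (Set.Icc 1 n : Set ℕ)) =
      (∑ x ∈ box n, f x) / (n : ℝ) ^ 3 := by
  have := isProbabilityMeasure_uniformOn (Set.finite_Icc 1 n) ⟨1, le_rfl, hn⟩
  have hmem : ∀ᵐ x ∂(Measure.pi fun _ : Fin 3 => uniformOn (Set.Icc 1 n : Set ℕ)),
      x ∈ (box n : Set (Fin 3 → ℕ)) := by
    have hset : (box n : Set (Fin 3 → ℕ)) = Set.univ.pi fun _ => Set.Icc 1 n := by
      ext x
      simp [mem_box, Pi.le_def, forall_and]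
    refine (mem_ae_iff_prob_eq_one (Finset.measurableSet _)).2 ?_
    rw [hset, Measure.pi_pi]
    simp [uniformOn_self (Set.finite_Icc 1 n) ⟨1, le_rfl, hn⟩]
  rw [← Measure.restrict_eq_self_of_ae_mem hmem, setIntegral_finset, Finset.sum_div]
  · refine Finset.sum_congr rfl fun x hx => ?_
    rw [pi_uniformOn_real_singleton hx, smul_eq_mul]
    ring
  · exact IntegrableOn.finset

lemma hasLaw_of_uniform {Ω : Type*} [MeasurableSpace Ω] {P : Measure Ω}
    [IsProbabilityMeasure P] {X : Fin 3 → Ω → ℕ} {n : ℕ}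
    (hunif : ∀ i, HasLaw (X i) (uniformOn (Set.Icc 1 n)) P) (hindep : iIndepFun X P) :
    HasLaw (fun w i => X i w) (Measure.pi fun _ : Fin 3 => uniformOn (Set.Icc 1 n : Set ℕ)) P := by
  have hm := fun i => (hunif i).aemeasurable
  have h := (iIndepFun_iff_map_fun_eq_pi_map hm).1 hindep
  simp only [fun i => (hunif i).map_eq] at h
  exact ⟨aemeasurable_pi_lambda _ hm, h⟩

lemma integral_comp_of_uniform {Ω : Type*} [MeasurableSpace Ω] {P : Measure Ω}
    [IsProbabilityMeasure P] {X : Fin 3 → Ω → ℕ} {n : ℕ} (hn : 1 ≤ n)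
    (hunif : ∀ i, HasLaw (X i) (uniformOn (Set.Icc 1 n)) P) (hindep : iIndepFun X P)
    (f : (Fin 3 → ℕ) → ℝ) :
    ∫ w, f (fun i => X i w) ∂P = (∑ x ∈ box n, f x) / (n : ℝ) ^ 3 := by
  have h := hasLaw_of_uniform hunif hindep
  rw [← integral_pi_uniformOn hn, ← h.map_eq, integral_map h.aemeasurable]
  exact (measurable_of_countable f).aestronglyMeasurable

open Classical in
lemma prob_of_uniform {Ω : Type*} [MeasurableSpace Ω] {P : Measure Ω}
    [IsProbabilityMeasure P] {X : Fin 3 → Ω → ℕ} {n : ℕ} (hn : 1 ≤ n)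
    (hunif : ∀ i, HasLaw (X i) (uniformOn (Set.Icc 1 n)) P) (hindep : iIndepFun X P)
    (A : (Fin 3 → ℕ) → Prop) :
    P.real {w | A fun i => X i w} = (((box n).filter A).card : ℝ) / (n : ℝ) ^ 3 := by
  have hA : MeasurableSet {x | A x} := (Set.to_countable _).measurableSet
  rw [(hasLaw_of_uniform hunif hindep).measureReal_eq hA, ← integral_indicator_one hA,
    integral_pi_uniformOn hn, ← Finset.sum_boole]
  rfl

/-! ### The two limits as sums over types -/

lemma one_le_sq_mul (k : ℕ+ × ℕ+) : (1 : ℝ) ≤ (k.1 : ℝ) ^ 2 * (k.2 : ℝ) := by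
  have h1 : (1 : ℝ) ≤ (k.1 : ℝ) := by exact_mod_cast k.1.pos
  have h2 : (1 : ℝ) ≤ (k.2 : ℝ) := by exact_mod_cast k.2.pos
  nlinarith [one_le_pow₀ h1 (n := 2)]

lemma ne_zero_of_mem_box {n : ℕ} {x : Fin 3 → ℕ} (hx : x ∈ box n) (i : Fin 3) : x i ≠ 0 :=
  (Nat.lt_of_lt_of_le Nat.zero_lt_one (mem_box.1 hx i).1).ne'

lemma prod_monotone : Monotone fun x : Fin 3 → ℕ => ((∏ i, x i : ℕ) : ℝ) := fun _ _ h =>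
  Nat.cast_le.2 (Finset.prod_le_prod' fun i _ => h i)

lemma lcmTriple_cast {x : Fin 3 → ℕ} (hx : ∀ i, x i ≠ 0) :
    (lcmTriple x : ℝ) * (((gcdType x).1 : ℝ) ^ 2 * ((gcdType x).2 : ℝ)) = ((∏ i, x i : ℕ) : ℝ) := by
  rw [← lcmTriple_mul_gcdType hx]
  push_cast
  rfl

open Classical in
-- The indicator of a small product decreases in the coordinates, so the increasing indicator of the
-- complement serves as the weight. This is why the limit has the form `1 - ∑ (1 - Ω_3)`.
lemma tendsto_card_lcmTriple_le (t : ℝ) :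
    Summable (fun k : ℕ+ × ℕ+ => typeDensity k *
      (1 - volOmega 3 (t * (k.1 : ℝ) ^ 2 * (k.2 : ℝ)))) ∧
    Tendsto (fun n : ℕ => (((box n).filter
      fun x => (lcmTriple x : ℝ) ≤ t * (n : ℝ) ^ 3).card : ℝ) / (n : ℝ) ^ 3) atTop
      (𝓝 (1 - ∑' k : ℕ+ × ℕ+, typeDensity k *
        (1 - volOmega 3 (t * (k.1 : ℝ) ^ 2 * (k.2 : ℝ))))) := by
  have hcompl : ∀ n, ∀ A : (Fin 3 → ℕ) → Prop,
      (((box n).filter A).card : ℝ) / (n : ℝ) ^ 3 =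
        (∑ _x ∈ box n, (1 : ℝ)) / (n : ℝ) ^ 3 -
          (∑ x ∈ box n, if A x then (0 : ℝ) else 1) / (n : ℝ) ^ 3 := by
    intro n A
    rw [← sub_div, ← Finset.sum_sub_distrib, ← Finset.sum_boole]
    congr 1
    exact Finset.sum_congr rfl fun x _ => by split_ifs <;> norm_num
  have h := tendsto_sum_gcdType (G := fun k n x =>
      if ((∏ i, x i : ℕ) : ℝ) ≤ t * (k.1 : ℝ) ^ 2 * (k.2 : ℝ) * (n : ℝ) ^ 3 then 0 else 1)
    (I := fun k => 1 - volOmega 3 (t * (k.1 : ℝ) ^ 2 * (k.2 : ℝ)))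
    (fun k => ⟨fun n x _ => by split_ifs <;> norm_num, fun n x _ => by split_ifs <;> norm_num,
      fun n x y hxy => by
        have := prod_monotone hxy
        dsimp only at this ⊢
        split_ifs with h1 h2 h2
        · exact le_rfl
        · exact zero_le_one
        · exact absurd (this.trans h2) h1
        · exact le_rfl⟩)
    (fun k => by
      refine (tendsto_card_box_div.sub
        (tendsto_card_prod_le (t * (k.1 : ℝ) ^ 2 * (k.2 : ℝ)))).congr fun n => ?_
      have := hcompl n fun x =>
        ((∏ i, x i : ℕ) : ℝ) ≤ t * (k.1 : ℝ) ^ 2 * (k.2 : ℝ) * (n : ℝ) ^ 3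
      rw [sub_eq_iff_eq_add, ← sub_eq_iff_eq_add', ← this])
  refine ⟨h.1, (tendsto_card_box_div.sub h.2).congr fun n => ?_⟩
  rw [hcompl n fun x => (lcmTriple x : ℝ) ≤ t * (n : ℝ) ^ 3]
  congr 2
  refine Finset.sum_congr rfl fun x hx => ?_
  have hiff : ((∏ i, x i : ℕ) : ℝ) ≤
      t * ((gcdType x).1 : ℝ) ^ 2 * ((gcdType x).2 : ℝ) * (n : ℝ) ^ 3 ↔
      (lcmTriple x : ℝ) ≤ t * (n : ℝ) ^ 3 := by
    rw [← lcmTriple_cast (ne_zero_of_mem_box hx),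
      show t * ((gcdType x).1 : ℝ) ^ 2 * ((gcdType x).2 : ℝ) * (n : ℝ) ^ 3 =
        t * (n : ℝ) ^ 3 * (((gcdType x).1 : ℝ) ^ 2 * ((gcdType x).2 : ℝ)) by ring]
    exact mul_le_mul_iff_left₀ (zero_lt_one.trans_le (one_le_sq_mul (gcdType x)))
  simp only [hiff]

/-- The weight for type `(j, m)` is the normalised product divided by `j² m`, to the power `q`. On
triples of that type it is `(lcm / n³) ^ q`, and `j² m ≥ 1` keeps it at most 1 on the whole box. -/
lemma tendsto_sum_lcmTriple_pow (q : ℕ) :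
    Summable (fun k : ℕ+ × ℕ+ => typeDensity k *
      (1 / ((q : ℝ) + 1) ^ 3 / ((k.1 : ℝ) ^ 2 * (k.2 : ℝ)) ^ q)) ∧
    Tendsto (fun n : ℕ => (∑ x ∈ box n, (lcmTriple x : ℝ) ^ q) / (n : ℝ) ^ 3 / (n : ℝ) ^ (3 * q))
      atTop (𝓝 (∑' k : ℕ+ × ℕ+, typeDensity k *
        (1 / ((q : ℝ) + 1) ^ 3 / ((k.1 : ℝ) ^ 2 * (k.2 : ℝ)) ^ q))) := by
  have h := tendsto_sum_gcdType (G := fun k n x =>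
      (((∏ i, x i : ℕ) : ℝ) / (n : ℝ) ^ 3) ^ q / ((k.1 : ℝ) ^ 2 * (k.2 : ℝ)) ^ q)
    (I := fun k => 1 / ((q : ℝ) + 1) ^ 3 / ((k.1 : ℝ) ^ 2 * (k.2 : ℝ)) ^ q)
    (fun k => ⟨fun n x _ => by positivity, fun n x hx => by
        refine div_le_one_of_le₀ (pow_le_pow_left₀ (by positivity) ?_ q) (by positivity)
        refine (div_le_one_of_le₀ ?_ (by positivity)).trans (one_le_sq_mul k)
        have : ∏ i, x i ≤ ∏ _i : Fin 3, n := Finset.prod_le_prod' fun i _ => (mem_box.1 hx i).2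
        rw [Finset.prod_const, Finset.card_univ, Fintype.card_fin] at this
        exact_mod_cast this,
      fun n x y hxy => by
        have := prod_monotone hxy
        dsimp only at this ⊢
        gcongr⟩)
    (fun k => by
      simp only [← Finset.sum_div]
      refine ((tendsto_sum_prod_pow q).div_const (((k.1 : ℝ) ^ 2 * (k.2 : ℝ)) ^ q)).congr
        fun n => ?_
      rw [div_right_comm])
  refine ⟨h.1, h.2.congr fun n => ?_⟩
  rw [div_right_comm, Finset.sum_div _ _ ((n : ℝ) ^ (3 * q))]
  congr 1
  refine Finset.sum_congr rfl fun x hx => ?_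
  have hpos := zero_lt_one.trans_le (one_le_sq_mul (gcdType x))
  rw [← lcmTriple_cast (ne_zero_of_mem_box hx), ← div_pow, div_right_comm,
    mul_div_cancel_right₀ _ hpos.ne', div_pow, pow_mul]

/-! ### Identification with the zeta function and the series `J` -/

lemma support_subset_range_pnat {M : Type*} [Zero M] {f : ℕ → M} (hf : f 0 = 0) :
    Function.support f ⊆ Set.range ((↑) : ℕ+ → ℕ) := fun n hn =>
  ⟨⟨n, Nat.pos_of_ne_zero fun h => hn (h ▸ hf)⟩, rfl⟩

lemma typeDensity_mul (k : ℕ+ × ℕ+) (a : ℝ) :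
    typeDensity k * a =
      constT 3 * (1 / (k.1 : ℝ) ^ 3 * (coeffJ k.2 / (k.2 : ℝ) ^ 2 * a)) := by
  rw [typeDensity]
  ring

lemma term_coeffJ (q : ℕ) (m : ℕ+) :
    LSeries.term (fun m : ℕ => (coeffJ m : ℂ)) ((q : ℂ) + 2) m =
      ((coeffJ m / (m : ℝ) ^ (q + 2) : ℝ) : ℂ) := by
  rw [LSeries.term_of_ne_zero m.ne_zero, show (q : ℂ) + 2 = ((q + 2 : ℕ) : ℂ) by push_cast; rfl,
    Complex.cpow_natCast]
  push_cast
  rfl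

lemma zeta_eq_tsum_pnat (q : ℕ) :
    riemannZeta (2 * (q : ℂ) + 3) = ((∑' j : ℕ+, 1 / (j : ℝ) ^ (2 * q + 3) : ℝ) : ℂ) := by
  rw [show 2 * (q : ℂ) + 3 = ((2 * q + 3 : ℕ) : ℂ) by push_cast; rfl,
    zeta_nat_eq_tsum_of_gt_one (by omega), Complex.ofReal_tsum,
    ← PNat.coe_injective.tsum_eq (support_subset_range_pnat (by simp))]
  refine tsum_congr fun j => ?_
  push_cast
  rfl

lemma summable_coeffJ_and_tsum (q : ℕ) :
    Summable (fun m : ℕ+ => coeffJ m / (m : ℝ) ^ (q + 2)) ∧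
    ∑' k : ℕ+ × ℕ+, typeDensity k *
        (1 / ((q : ℝ) + 1) ^ 3 / ((k.1 : ℝ) ^ 2 * (k.2 : ℝ)) ^ q) =
      constT 3 * ((∑' j : ℕ+, 1 / (j : ℝ) ^ (2 * q + 3)) / ((q : ℝ) + 1) ^ 3) *
        ∑' m : ℕ+, coeffJ m / (m : ℝ) ^ (q + 2) := by
  have hq : ((q : ℝ) + 1) ^ 3 ≠ 0 := by positivity
  have heq : ∀ k : ℕ+ × ℕ+, typeDensity k *
        (1 / ((q : ℝ) + 1) ^ 3 / ((k.1 : ℝ) ^ 2 * (k.2 : ℝ)) ^ q) =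
      constT 3 / ((q : ℝ) + 1) ^ 3 *
        (1 / (k.1 : ℝ) ^ (2 * q + 3) * (coeffJ k.2 / (k.2 : ℝ) ^ (q + 2))) := by
    intro k
    have h1 : (k.1 : ℝ) ≠ 0 := by exact_mod_cast k.1.ne_zero
    have h2 : (k.2 : ℝ) ≠ 0 := by exact_mod_cast k.2.ne_zero
    rw [typeDensity, mul_pow]
    field_simp
    ring
  have hsum := (tendsto_sum_lcmTriple_pow q).1
  simp only [heq] at hsum ⊢
  rw [summable_mul_left_iff (div_ne_zero constT_three_ne_zero hq)] at hsum
  constructor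
  -- The row `j = 1` of the summable double series is the series `J` itself.
  · have := hsum.comp_injective (i := fun m : ℕ+ => ((1 : ℕ+), m)) fun a b h => (Prod.ext_iff.1 h).2
    simpa [Function.comp_def] using this
  · rw [tsum_mul_left, hsum.tsum_prod]
    simp only [tsum_mul_left, tsum_mul_right]
    ring

end LcmTriples

/-- For each `n ≥ 1`, `X n 0`, `X n 1`, `X n 2` are independent random variables, uniformly
distributed on `{1, …, n}`. Convergence of the infinite product and of the series in the limits is
part of the conclusion. -/
theorem theorem3 {Ω : ℕ → Type*} [∀ n, MeasurableSpace (Ω n)]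
    (P : (n : ℕ) → Measure (Ω n)) [∀ n, IsProbabilityMeasure (P n)]
    (X : (n : ℕ) → Fin 3 → Ω n → ℕ)
    (hunif : ∀ n, 1 ≤ n → ∀ i, HasLaw (X n i) (uniformOn (Set.Icc 1 n)) (P n))
    (hindep : ∀ n, 1 ≤ n → iIndepFun (X n) (P n)) :
    Multipliable (fun p : Nat.Primes => LcmTriples.factorT 3 p) ∧
    (∀ t : ℝ, 0 ≤ t → t ≤ 1 →
      Summable (fun k : ℕ+ × ℕ+ =>
        1 / (k.1 : ℝ) ^ 3 * (LcmTriples.coeffJ k.2 / (k.2 : ℝ) ^ 2 *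
          (1 - LcmTriples.volOmega 3 (t * (k.1 : ℝ) ^ 2 * (k.2 : ℝ))))) ∧
      Tendsto
        (fun n : ℕ => (P n).real
          {w | (LcmTriples.lcmTriple (fun i => X n i w) : ℝ) ≤ t * (n : ℝ) ^ 3})
        atTop
        (𝓝 (1 - LcmTriples.constT 3 *
          ∑' j : ℕ+, 1 / (j : ℝ) ^ 3 *
            ∑' m : ℕ+, LcmTriples.coeffJ m / (m : ℝ) ^ 2 *
              (1 - LcmTriples.volOmega 3 (t * (j : ℝ) ^ 2 * (m : ℝ)))))) ∧
    (∀ q : ℕ, 1 ≤ q →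
      LSeriesSummable (fun m : ℕ => (LcmTriples.coeffJ m : ℂ)) ((q : ℂ) + 2) ∧
      Tendsto
        (fun n : ℕ =>
          (((∫ w, (LcmTriples.lcmTriple (fun i => X n i w) : ℝ) ^ q ∂(P n)) /
            (n : ℝ) ^ (3 * q) : ℝ) : ℂ))
        atTop
        (𝓝 ((LcmTriples.constT 3 : ℂ) *
          (riemannZeta (2 * (q : ℂ) + 3) / ((q : ℂ) + 1) ^ 3) *
          LcmTriples.seriesJ ((q : ℂ) + 2)))) := by
  refine ⟨LcmTriples.multipliable_factorT, fun t _ _ => ?_, fun q _ => ?_⟩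
  · obtain ⟨hsum, hlim⟩ := LcmTriples.tendsto_card_lcmTriple_le t
    simp only [LcmTriples.typeDensity_mul] at hsum hlim
    rw [summable_mul_left_iff LcmTriples.constT_three_ne_zero] at hsum
    refine ⟨hsum, ?_⟩
    rw [tsum_mul_left, hsum.tsum_prod] at hlim
    simp only [tsum_mul_left] at hlim
    refine hlim.congr' ?_
    filter_upwards [eventually_ge_atTop 1] with n hn
    exact (LcmTriples.prob_of_uniform hn (hunif n hn) (hindep n hn)
      fun x => (LcmTriples.lcmTriple x : ℝ) ≤ t * (n : ℝ) ^ 3).symm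
  · obtain ⟨hsum, htsum⟩ := LcmTriples.summable_coeffJ_and_tsum q
    have hlim := (LcmTriples.tendsto_sum_lcmTriple_pow q).2
    rw [htsum] at hlim
    have h0 : LSeries.term (fun m : ℕ => (LcmTriples.coeffJ m : ℂ)) ((q : ℂ) + 2) 0 = 0 :=
      LSeries.term_zero _ _
    constructor
    · rw [LSeriesSummable, ← PNat.coe_injective.summable_iff fun n hn =>
        Function.notMem_support.1 fun h => hn (LcmTriples.support_subset_range_pnat h0 h)]
      simp only [Function.comp_def, LcmTriples.term_coeffJ]
      exact Complex.ofRealCLM.summable hsum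
    · have hJ : LcmTriples.seriesJ ((q : ℂ) + 2) =
          ((∑' m : ℕ+, LcmTriples.coeffJ m / (m : ℝ) ^ (q + 2) : ℝ) : ℂ) := by
        rw [LcmTriples.seriesJ, LSeries, Complex.ofReal_tsum,
          ← PNat.coe_injective.tsum_eq (LcmTriples.support_subset_range_pnat h0)]
        exact tsum_congr fun m => LcmTriples.term_coeffJ q m
      rw [hJ, LcmTriples.zeta_eq_tsum_pnat]
      have h := (Complex.continuous_ofReal.tendsto _).comp hlim
      push_cast at h ⊢
      refine h.congr' ?_
      filter_upwards [eventually_ge_atTop 1] with n hn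
      have := LcmTriples.integral_comp_of_uniform hn (hunif n hn) (hindep n hn)
        fun x => (LcmTriples.lcmTriple x : ℝ) ^ q
      simp only [Function.comp_apply]
      rw [this]
      push_cast
      rfl
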